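/- **Setting.** Let $d,\ell\ge 1$ be integers, where $\ell\le 2$ if $d=1$. Define simplicial complexes $\mathcal L_1\subseteq\mathcal L_2\subseteq\cdots\subseteq\mathcal L_\ell=\mathcal L$ as follows. $\mathcal L_1=\Delta^d$ is the full simplex on the vertices $1,\dots,d+1$. For $2\le k\le\ell$, $\mathcal L_k$ is obtained from $\mathcal L_{k-1}$ by stacking a $d$-simplex with one new vertex $d+k$ onto the facet $(1,\dots,d)$ if $k=2$, and onto the facet $(1,\dots,d-1,d+k-1)$ if $k>2$. So $\mathcal L$ is a stacked polytope with $\ell$ stacks on the vertex set $\{1,\dots,d+\ell\}$. Let $\partial\mathcal L$ be its boundary, i.e. the subcomplex generated by the $(d-1)$-dimensional faces that lie in exactly one $d$-dimensional face, and let $\partial\mathcal L-\{1\}$ be the full subcomplex of $\partial\mathcal L$ on the vertex set $\{2,\dots,d+\ell\}$. Let $P_\ell$ be the complex of $\ell$ disjoint points. For a simplicial complex $K$ on a finite vertex set $W$ and a pair $(Y,A)$, let $(Y,A)^K=\bigcup_{\sigma\in K}\{(y_v)\in\prod_{v\in W}Y : y_v\in A\text{ for }v\notin\sigma\}$, the union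 including $\sigma=\emptyset$. Let $CX=(X\times[0,1])/(X\times\{1\})$ be the cone on $X$, which contains $X$ as $X\times\{0\}$, and let $\mathcal Z_K=(D^2,S^1)^K$ be the moment-angle complex. **Claim.** (a) $\mathcal L$ has exactly $\ell d+1$ faces of dimension $d-1$. (b) Exactly $\ell$ of the faces in (a) do not contain the vertex $1$: $(2,\dots,d,d+1)$, $(2,\dots,d,d+2)$ (if $\ell\ge2$), and $(2,\dots,d-1,d+k-1,d+k)$ for $2<k\le\ell$. These are also exactly the $(d-1)$-dimensional faces of $\partial\mathcal L$ that do not contain the vertex $1$. (c) There is a filtration $M_1=\Delta^{d-1}\subseteq M_2\subseteq\cdots\subseteq M_\ell=\partial\mathcal L-\{1\}$ by simplicial complexes such that, for $2\le k\le\ell$, $M_k=M_{k-1}\cup_{\sigma_k}\Delta^{d-1}$ is obtained by gluing on a $(d-1)$-simplex along a common $(d-2)$-dimensional face $\sigma_k=\Delta^{d-2}$, that is, $M_{k-1}\cap\Delta^{d-1}=\sigma_k$ (with $\Delta^{-1}=\emptyset$). (d) For every nonempty topological space $X$ (in particular, every pointed CW-complex) there is a homotopy equivalence $(CX,X)^{\partial\mathcal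 L-\{1\}}\simeq(CX,X)^{P_\ell}$. (e) There are homotopy equivalences $$\mathcal Z_{\partial\mathcal L-\{1\}}\simeq\mathcal Z_{P_\ell}\simeq\bigvee_{k=3}^{\ell+1}\ \bigvee_{j=1}^{(k-2)\binom{\ell}{k-1}}S^k,$$ where the empty wedge (the case $\ell=1$) is a point. -/

import Mathlib

namespace PolyProd

/-! ### Simplicial complexes

A simplicial complex is a downward closed set of nonempty finite sets of vertices
(`PreAbstractSimplicialComplex`); the empty simplex is left implicit. A face with `n + 1`
vertices has dimension `n`. -/

/-- The full simplex on the finite vertex set `F` (with all its nonempty faces). -/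
def simplex {V : Type*} (F : Finset V) : PreAbstractSimplicialComplex V where
  faces := {τ | τ.Nonempty ∧ τ ⊆ F}
  isRelLowerSet_faces := fun _ h => ⟨h.1, fun _ ht hn => ⟨hn, ht.trans h.2⟩⟩

/-- The complex of disjoint points: its faces are the single vertices `{v}` with `v ∈ W`. -/
def points {V : Type*} (W : Finset V) : PreAbstractSimplicialComplex V where
  faces := {τ | ∃ v ∈ W, τ = {v}}
  isRelLowerSet_faces := by
    rintro _ ⟨v, hv, rfl⟩
    refine ⟨Finset.singleton_nonempty v, fun t ht hn => ⟨v, hv, ?_⟩⟩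
    exact (Finset.subset_singleton_iff.mp ht).resolve_left hn.ne_empty

/-- The full subcomplex of `K` on the vertex set `W`: all faces of `K` whose vertices lie
in `W`. -/
def fullSubcomplex {V : Type*} (K : PreAbstractSimplicialComplex V) (W : Finset V) :
    PreAbstractSimplicialComplex V where
  faces := {τ | τ ∈ K.faces ∧ τ ⊆ W}
  isRelLowerSet_faces := fun _ h =>
    ⟨(K.isRelLowerSet_faces h.1).1,
      fun _ ht hn => ⟨(K.isRelLowerSet_faces h.1).2 ht hn, Finset.Subset.trans ht h.2⟩⟩

/-- The boundary of a `d`-dimensional complex `K` (such as a triangulated `d`-ball): the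
subcomplex generated by the `(d-1)`-dimensional faces of `K` that lie in exactly one
`d`-dimensional face of `K`. -/
def boundary {V : Type*} (d : ℕ) (K : PreAbstractSimplicialComplex V) :
    PreAbstractSimplicialComplex V where
  faces := {τ | τ.Nonempty ∧ ∃ σ ∈ K.faces, σ.card = d ∧ τ ⊆ σ ∧
    ∃! ρ : Finset V, ρ ∈ K.faces ∧ ρ.card = d + 1 ∧ σ ⊆ ρ}
  isRelLowerSet_faces := fun _ h => by
    obtain ⟨hn, σ, hσ, hc, hs, hu⟩ := h
    exact ⟨hn, fun _ ht hn' => ⟨hn', σ, hσ, hc, Finset.Subset.trans ht hs, hu⟩⟩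

/-- Stacking: glue onto `K`, along the face `σ`, the simplex spanned by `σ` and the new
vertex `v`. -/
def stack {V : Type*} [DecidableEq V] (K : PreAbstractSimplicialComplex V) (σ : Finset V)
    (v : V) : PreAbstractSimplicialComplex V :=
  K ⊔ simplex (insert v σ)

/-- The facet of the `(k-1)`-st complex onto which the `k`-th stack is glued (`k ≥ 2`): it is
`(1, …, d)` for `k = 2` and `(1, …, d-1, d+k-1)` for `k > 2`. -/
def stackFacet (d k : ℕ) : Finset ℕ :=
  if k = 2 then Finset.Icc 1 d else insert (d + k - 1) (Finset.Icc 1 (d - 1))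

/-- The stacked polytope of dimension `d` with `ℓ ≥ 1` stacks, as a simplicial complex on the
vertices `1, …, d + ℓ`: start with the `d`-simplex `(1, …, d+1)`; the `k`-th step stacks the new
vertex `d + k` onto `stackFacet d k`. (The value at `ℓ = 0` is irrelevant.) -/
def stacked (d : ℕ) : ℕ → PreAbstractSimplicialComplex ℕ
  | 0 => ⊥
  | 1 => simplex (Finset.Icc 1 (d + 1))
  | k + 2 => stack (stacked d (k + 1)) (stackFacet d (k + 2)) (d + (k + 2))

/-- The vertex set `{2, …, d + ℓ}` that remains when the vertex `1` is deleted. -/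
def deletedVertices (d ℓ : ℕ) : Finset ℕ := (Finset.Icc 1 (d + ℓ)).erase 1

/-- `∂L - {1}`: the full subcomplex of the boundary of the stacked polytope on the vertex set
`{2, …, d + ℓ}`. -/
def deleted (d ℓ : ℕ) : PreAbstractSimplicialComplex ℕ :=
  fullSubcomplex (boundary d (stacked d ℓ)) (deletedVertices d ℓ)

/-- The list `(2, …, d, d+1)`, `(2, …, d, d+2)` and `(2, …, d-1, d+k-1, d+k)` for `k > 2`. -/
def deletedFacet (d k : ℕ) : Finset ℕ :=
  if k = 1 then insert (d + 1) (Finset.Icc 2 d)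
  else if k = 2 then insert (d + 2) (Finset.Icc 2 d)
  else insert (d + k) (insert (d + k - 1) (Finset.Icc 2 (d - 1)))

/-- `K` is filtered as `M₁ ⊆ M₂ ⊆ ⋯ ⊆ M_ℓ = K`, where `M₁` is an `(n-1)`-simplex and `M_k`
arises from `M_{k-1}` by gluing on an `(n-1)`-simplex along a common `(n-2)`-face. -/
def IsSuccessiveGluing {V : Type*} (n ℓ : ℕ) (K : PreAbstractSimplicialComplex V) : Prop :=
  ∃ M : ℕ → PreAbstractSimplicialComplex V,
    (∃ F : Finset V, F.card = n ∧ M 1 = simplex F) ∧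
    (∀ k, 2 ≤ k → k ≤ ℓ → ∃ F σ : Finset V, F.card = n ∧ σ.card + 1 = n ∧ σ ⊆ F ∧
      M (k - 1) ⊓ simplex F = simplex σ ∧ M k = M (k - 1) ⊔ simplex F) ∧
    M ℓ = K

/-! ### Polyhedral products -/

/-- The polyhedral product of the pairs `(Y v, A v)` for a simplicial complex `K` on the vertex
set `W`: the union over all simplices `σ` of `K`, the empty one included, of the products with
factor `Y v` for `v ∈ σ` and `A v` for `v ∉ σ`; a subspace of the product of all `Y v`. -/
def polyhedralProduct {V : Type*} (W : Finset V) (K : PreAbstractSimplicialComplex V)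
    (Y : V → Type*) (A : ∀ v, Set (Y v)) : Set (∀ v : W, Y v) :=
  {x | ∃ σ : Finset V, (σ = ∅ ∨ σ ∈ K.faces) ∧ σ ⊆ W ∧ ∀ v : W, (v : V) ∉ σ → x v ∈ A v}

/-- The equivalence relation that collapses the subset `S` to one point. -/
def collapse {X : Type*} (S : Set X) : Setoid X where
  r p q := p = q ∨ (p ∈ S ∧ q ∈ S)
  iseqv :=
    { refl := fun _ => Or.inl rfl
      symm := by
        rintro p q (h | h)
        · exact Or.inl h.symm
        · exact Or.inr h.symm
      trans := by
        rintro p q r (rfl | h) (rfl | h')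
        · exact Or.inl rfl
        · exact Or.inr h'
        · exact Or.inr h
        · exact Or.inr ⟨h.1, h'.2⟩ }

/-- The cone `CX = (X × [0,1]) / (X × {1})`, with the quotient topology. -/
def Cone (X : Type*) : Type _ :=
  Quotient (collapse {p : X × unitInterval | p.2 = 1})

instance (X : Type*) [TopologicalSpace X] : TopologicalSpace (Cone X) :=
  inferInstanceAs (TopologicalSpace (Quotient _))

/-- The copy of `X` at the base of its cone `CX`. -/
def Cone.base (X : Type*) : Set (Cone X) :=
  Set.range fun x : X => Quotient.mk (collapse {p : X × unitInterval | p.2 = 1}) (x, 0)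

/-- `(CX, X)^K` for a simplicial complex `K` on the vertex set `W`. -/
abbrev ConeProduct {V : Type*} (X : Type*) (W : Finset V)
    (K : PreAbstractSimplicialComplex V) : Type _ :=
  polyhedralProduct W K (fun _ => Cone X) (fun _ => Cone.base X)

/-- The moment-angle complex `(D², S¹)^K` of a simplicial complex `K` on the vertex set `W`. -/
abbrev MomentAngle {V : Type*} (W : Finset V) (K : PreAbstractSimplicialComplex V) : Type _ :=
  polyhedralProduct W K (fun _ => Metric.closedBall (0 : ℂ) 1) (fun _ => {z | ‖(z : ℂ)‖ = 1})

/-! ### Wedges of spheres -/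

/-- The wedge of the pointed spaces `(Y i, y i)`: the disjoint union of a point and of all `Y i`,
with that point and all base points identified. The empty wedge is a point. -/
def Wedge {ι : Type*} (Y : ι → Type*) (y : ∀ i, Y i) : Type _ :=
  Quotient (collapse (Set.range (Sum.inl : Unit → Unit ⊕ Σ i, Y i) ∪
    Set.range fun i => (Sum.inr ⟨i, y i⟩ : Unit ⊕ Σ i, Y i)))

instance {ι : Type*} (Y : ι → Type*) (y : ∀ i, Y i) [∀ i, TopologicalSpace (Y i)] :
    TopologicalSpace (Wedge Y y) :=
  inferInstanceAs (TopologicalSpace (Quotient _))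

/-- The unit sphere `S^k` in `ℝ^(k+1)`. -/
abbrev Sphere (k : ℕ) : Type := Metric.sphere (0 : EuclideanSpace ℝ (Fin (k + 1))) 1

/-- The base point `(1, 0, …, 0)` of `S^k`. -/
noncomputable def spherePoint (k : ℕ) : Sphere k :=
  ⟨EuclideanSpace.single 0 1, by simp⟩

/-- The wedge, over `3 ≤ k ≤ ℓ + 1`, of `(k-2) * (ℓ choose (k-1))` copies of `S^k`. -/
abbrev SphereWedge (ℓ : ℕ) : Type :=
  Wedge
    (fun i : (Σ k : Finset.Icc 3 (ℓ + 1), Fin (((k : ℕ) - 2) * ℓ.choose ((k : ℕ) - 1))) =>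
      Sphere (i.1 : ℕ))
    (fun i => spherePoint (i.1 : ℕ))

end PolyProd

-- Every facet of `stacked d ℓ` contains the vertex 1 (this needs `ℓ ≤ 2` when `d = 1`), so the
-- complex is the cone with apex 1 over the complex generated by the sets `deletedFacet d k`. Each
-- of these ridges lies in exactly one facet. This gives both lists of ridges and shows that
-- `deleted d ℓ` is generated by them (`mem_deleted_iff`). The facet number `k + 1` has one new
-- vertex, and its other vertices lie in the facet number `k`; hence the successive gluing.
--
-- Stack the simplex on `σ ∪ {v}` onto a complex `K` with vertex set `W`. The polyhedral product
-- becomes `(Y,A)^K × A ∪ F × Y`, where `F` consists of the points with coordinates in `A` outside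
-- `σ`. If `Y` is contractible and `A → Y` is a cofibration, this is the homotopy pushout of
-- `(Y,A)^K × A ← F × A → F`, and `F` is equivalent to the power of `A` over `W \ σ`. The inclusion
-- of `F` into `(Y,A)^K` is nullhomotopic, because every vertex of `W` is a face of `K`
-- (`facePart_homotopic_const`). So the result depends, up to homotopy, only on `(Y,A)^K` and the
-- size of `W \ σ` (`IsStackable.hEquiv`). When the simplex number `k + 1` is added to `∂L - {1}`,
-- this size is `(d + k - 1) - (d - 1) = k`, the same as for adding a point to `k` points, with `σ =
-- ∅`. Induction on `ℓ` compares the two polyhedral products, for cones and for discs.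
--
-- For the pair `(D², S¹)` and `m` points, the pushout is a half join: the half-smash product of the
-- old space with the circle, wedge the join of the `m`-torus with the circle. The half-smash of
-- `S^k` with the circle is `S^k ∨ S^(k+1)` (`halfSmash_hEquiv`), and the joins of tori with the
-- circle satisfy a similar recursion (`join_prod_hEquiv`). The lists of sphere dimensions are then
-- counted by Pascal's rule.

universe u

namespace PolyProd

open Topology unitInterval

/-! ### Homotopy pushouts -/

section HoPushout

variable {A B C : Type u} [TopologicalSpace A] [TopologicalSpace B] [TopologicalSpace C]

/-- The gluing relation of the double mapping cylinder. -/
inductive HoPushout.Rel (f : C(C, A)) (g : C(C, B)) : A ⊕ (I × C) ⊕ B → A ⊕ (I × C) ⊕ B → Prop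
  | left (c : C) : Rel f g (Sum.inr (Sum.inl (0, c))) (Sum.inl (f c))
  | right (c : C) : Rel f g (Sum.inr (Sum.inl (1, c))) (Sum.inr (Sum.inr (g c)))

/-- The homotopy pushout (double mapping cylinder) of two maps with the same source. -/
def HoPushout (f : C(C, A)) (g : C(C, B)) : Type u := Quot (HoPushout.Rel f g)

instance (f : C(C, A)) (g : C(C, B)) : TopologicalSpace (HoPushout f g) :=
  inferInstanceAs (TopologicalSpace (Quot _))

namespace HoPushout

variable (f : C(C, A)) (g : C(C, B))

/-- The inclusion of the left end. -/
def inl : C(A, HoPushout f g) := ⟨fun a => Quot.mk _ (Sum.inl a), by fun_prop⟩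

/-- The inclusion of the right end. -/
def inr : C(B, HoPushout f g) := ⟨fun b => Quot.mk _ (Sum.inr (Sum.inr b)), by fun_prop⟩

/-- The cylinder that connects both ends. -/
def glue : C(I × C, HoPushout f g) := ⟨fun c => Quot.mk _ (Sum.inr (Sum.inl c)), by fun_prop⟩

@[simp] lemma glue_zero (c : C) : glue f g (0, c) = inl f g (f c) := Quot.sound (Rel.left c)

@[simp] lemma glue_one (c : C) : glue f g (1, c) = inr f g (g c) := Quot.sound (Rel.right c)

variable {f g}

lemma cases {p : HoPushout f g → Prop} (hl : ∀ a, p (inl f g a)) (hr : ∀ b, p (inr f g b))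
    (hg : ∀ c, p (glue f g c)) (x : HoPushout f g) : p x := by
  induction x using Quot.ind with
  | mk x =>
    rcases x with a | c | b
    · exact hl a
    · exact hg c
    · exact hr b

variable {Z : Type*} [TopologicalSpace Z]

/-- The map out of a homotopy pushout given by two maps and a homotopy. -/
def desc (a : C(A, Z)) (b : C(B, Z)) (h : C(I × C, Z)) (h0 : ∀ c, h (0, c) = a (f c))
    (h1 : ∀ c, h (1, c) = b (g c)) : C(HoPushout f g, Z) where
  toFun := Quot.lift (Sum.elim a (Sum.elim h b)) (by
    rintro _ _ (c | c)
    · exact h0 c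
    · exact h1 c)
  continuous_toFun := continuous_quot_lift _ (by fun_prop)

section
variable (a : C(A, Z)) (b : C(B, Z)) (h : C(I × C, Z)) (h0 : ∀ c, h (0, c) = a (f c))
    (h1 : ∀ c, h (1, c) = b (g c))

@[simp] lemma desc_inl (x : A) : desc a b h h0 h1 (inl f g x) = a x := rfl
@[simp] lemma desc_inr (x : B) : desc a b h h0 h1 (inr f g x) = b x := rfl
@[simp] lemma desc_glue (x : I × C) : desc a b h h0 h1 (glue f g x) = h x := rfl
end

/-- The homotopy is built as a map into the path space `C(I, Z)`, where the universal property of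
the quotient applies directly, and is then uncurried. -/
lemma homotopic_of (φ ψ : C(HoPushout f g, Z)) (U : C(I × A, Z)) (V : C(I × B, Z))
    (S : C(I × I × C, Z)) (S0 : ∀ t c, S (t, 0, c) = U (t, f c))
    (S1 : ∀ t c, S (t, 1, c) = V (t, g c))
    (U0 : ∀ a, U (0, a) = φ (inl f g a)) (U1 : ∀ a, U (1, a) = ψ (inl f g a))
    (V0 : ∀ b, V (0, b) = φ (inr f g b)) (V1 : ∀ b, V (1, b) = ψ (inr f g b))
    (h0 : ∀ s c, S (0, s, c) = φ (glue f g (s, c)))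
    (h1 : ∀ s c, S (1, s, c) = ψ (glue f g (s, c))) : φ.Homotopic ψ := by
  let D : C(HoPushout f g, C(I, Z)) :=
    desc (U.comp ContinuousMap.prodSwap).curry (V.comp ContinuousMap.prodSwap).curry
      (S.comp ContinuousMap.prodSwap).curry
      (fun c => ContinuousMap.ext fun t => S0 t c) (fun c => ContinuousMap.ext fun t => S1 t c)
  refine ⟨⟨D.uncurry.comp ContinuousMap.prodSwap, fun x => ?_, fun x => ?_⟩⟩
  · induction x using cases with
    | hl a => exact U0 a
    | hr b => exact V0 b
    | hg c => exact h0 c.1 c.2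
  · induction x using cases with
    | hl a => exact U1 a
    | hr b => exact V1 b
    | hg c => exact h1 c.1 c.2

end HoPushout
end HoPushout

/-! ### Concatenation of homotopies -/

section Concat

variable {C Z : Type*} [TopologicalSpace C] [TopologicalSpace Z]

/-- The concatenation of two homotopies, as a homotopy parametrized by the real line that runs
through the first one over `[0, 1]` and through the second one over `[1, 2]`. -/
noncomputable def concat (F G : C(I × C, Z)) (h : ∀ c, F (1, c) = G (0, c)) : C(ℝ × C, Z) where
  -- `projIcc` extends both homotopies by constants, so any real reparametrization can be
  -- substituted; two of them are later compared along straight lines in `ℝ`.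
  toFun p := if p.1 ≤ 1 then F (Set.projIcc 0 1 zero_le_one p.1, p.2)
    else G (Set.projIcc 0 1 zero_le_one (p.1 - 1), p.2)
  continuous_toFun := by
    refine Continuous.if_le (by fun_prop) (by fun_prop) (by fun_prop) (by fun_prop) ?_
    rintro ⟨r, c⟩ hr
    obtain rfl : r = 1 := hr
    simpa [Set.projIcc_of_le_left] using h c

variable {F G : C(I × C, Z)} {h : ∀ c, F (1, c) = G (0, c)}

lemma concat_left (s : I) (c : C) : concat F G h (s, c) = F (s, c) := by
  simp [concat, s.2.2]

lemma concat_right (s : I) (c : C) : concat F G h (1 + s, c) = G (s, c) := by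
  by_cases hs : s = 0
  · subst hs
    simpa [concat] using h c
  · have : ¬ (1 + (s : ℝ) ≤ 1) := by
      have := unitInterval.pos_iff_ne_zero.2 hs
      have : (0 : ℝ) < s := this
      linarith
    simp [concat, this]

lemma concat_zero (c : C) : concat F G h (0, c) = F (0, c) := by
  simpa using concat_left (h := h) 0 c

lemma concat_one (c : C) : concat F G h (1, c) = F (1, c) := by
  simpa using concat_left (h := h) 1 c

lemma concat_two (c : C) : concat F G h (2, c) = G (1, c) := by
  have := concat_right (h := h) 1 c
  norm_num at this
  exact this

lemma concat_of_le {r : ℝ} (hr : r ∈ Set.Icc (0 : ℝ) 1) (c : C) :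
    concat F G h (r, c) = F (⟨r, hr⟩, c) := concat_left (h := h) ⟨r, hr⟩ c

lemma concat_of_ge {r : ℝ} (hr : r - 1 ∈ Set.Icc (0 : ℝ) 1) (c : C) :
    concat F G h (r, c) = G (⟨r - 1, hr⟩, c) := by
  simpa using concat_right (h := h) ⟨r - 1, hr⟩ c

/-- The concatenation of two homotopies, at double speed. -/
noncomputable def concatI (F G : C(I × C, Z)) (h : ∀ c, F (1, c) = G (0, c)) : C(I × C, Z) :=
  (concat F G h).comp ⟨fun p => (2 * (p.1 : ℝ), p.2), by fun_prop⟩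

lemma concatI_apply (s : I) (c : C) : concatI F G h (s, c) = concat F G h (2 * (s : ℝ), c) := rfl

@[simp] lemma concatI_zero (c : C) : concatI F G h (0, c) = F (0, c) := by
  simp [concatI_apply, concat_zero]

@[simp] lemma concatI_one (c : C) : concatI F G h (1, c) = G (1, c) := by
  simp [concatI_apply, concat_two]

end Concat

/-! ### Homotopy equivalences -/

section IsHEq

variable {X Y Z W : Type*} [TopologicalSpace X] [TopologicalSpace Y] [TopologicalSpace Z]
  [TopologicalSpace W]

open ContinuousMap

/-- The map `f` is a homotopy equivalence. -/
def IsHEq (f : C(X, Y)) : Prop :=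
  ∃ g : C(Y, X), (g.comp f).Homotopic (.id X) ∧ (f.comp g).Homotopic (.id Y)

/-- The spaces `X` and `Y` are homotopy equivalent. -/
abbrev HEquiv (X Y : Type*) [TopologicalSpace X] [TopologicalSpace Y] : Prop :=
  Nonempty (HomotopyEquiv X Y)

lemma HEquiv.refl (X : Type*) [TopologicalSpace X] : HEquiv X X := ⟨.refl X⟩
lemma HEquiv.symm (h : HEquiv X Y) : HEquiv Y X := h.map ContinuousMap.HomotopyEquiv.symm
lemma HEquiv.trans (h : HEquiv X Y) (h' : HEquiv Y Z) : HEquiv X Z := ⟨h.some.trans h'.some⟩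
lemma _root_.Homeomorph.hEquiv (h : X ≃ₜ Y) : HEquiv X Y := ⟨h.toHomotopyEquiv⟩

lemma IsHEq.hEquiv {f : C(X, Y)} (h : IsHEq f) : HEquiv X Y := by
  obtain ⟨g, h1, h2⟩ := h
  exact ⟨⟨f, g, h1, h2⟩⟩

lemma HEquiv.exists_isHEq (h : HEquiv X Y) : ∃ f : C(X, Y), IsHEq f :=
  ⟨h.some.toFun, h.some.invFun, h.some.left_inv, h.some.right_inv⟩

lemma isHEq_id : IsHEq (ContinuousMap.id X) := ⟨.id X, .refl _, .refl _⟩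

lemma _root_.Homeomorph.isHEq (e : X ≃ₜ Y) : IsHEq (e : C(X, Y)) :=
  ⟨(e.symm : C(Y, X)), by
    rw [show (e.symm : C(Y, X)).comp (e : C(X, Y)) = .id X by ext; simp], by
    rw [show (e : C(X, Y)).comp (e.symm : C(Y, X)) = .id Y by ext; simp]⟩

lemma IsHEq.congr {f f' : C(X, Y)} (h : IsHEq f) (hf : f.Homotopic f') : IsHEq f' := by
  obtain ⟨g, h1, h2⟩ := h
  exact ⟨g, ((Homotopic.refl g).comp hf.symm).trans h1, (hf.symm.comp (.refl g)).trans h2⟩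

lemma IsHEq.comp {g : C(Y, Z)} {f : C(X, Y)} (hg : IsHEq g) (hf : IsHEq f) :
    IsHEq (g.comp f) := by
  obtain ⟨g', g1, g2⟩ := hg
  obtain ⟨f', f1, f2⟩ := hf
  refine ⟨f'.comp g', ?_, ?_⟩
  · exact (((Homotopic.refl f').comp (g1.comp (.refl f)))).trans f1
  · exact (((Homotopic.refl g).comp (f2.comp (.refl g')))).trans g2

lemma IsHEq.of_left_right {f : C(X, Y)} {g g' : C(Y, X)} (hl : (g.comp f).Homotopic (.id X))
    (hr : (f.comp g').Homotopic (.id Y)) : IsHEq f := by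
  refine ⟨g, hl, ?_⟩
  have : g.Homotopic g' :=
    ((Homotopic.refl g).comp hr.symm).trans (hl.comp (.refl g'))
  exact ((Homotopic.refl f).comp this).trans hr

/-- Two out of six, for the first map. -/
lemma IsHEq.of_two_of_six {f : C(X, Y)} {g : C(Y, Z)} {k : C(Z, W)} (h1 : IsHEq (g.comp f))
    (h2 : IsHEq (k.comp g)) : IsHEq f := by
  obtain ⟨a, a1, a2⟩ := h1
  obtain ⟨b, b1, b2⟩ := h2
  -- `g` has a left inverse `b ∘ k` and a right inverse `f ∘ a` up to homotopy, so it is an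
  -- equivalence and cancels from `g ∘ f`.
  have hg : IsHEq g := IsHEq.of_left_right (g := b.comp k) (g' := f.comp a) b1 a2
  obtain ⟨g', g1, g2⟩ := hg
  have : IsHEq (g'.comp (g.comp f)) := IsHEq.comp ⟨g, g2, g1⟩ ⟨a, a1, a2⟩
  exact this.congr (g1.comp (.refl f))

lemma IsHEq.of_comp_left {f : C(X, Y)} {g : C(Y, Z)} (hg : IsHEq g) (h : IsHEq (g.comp f)) :
    IsHEq f := by
  obtain ⟨g', g1, g2⟩ := hg
  exact (IsHEq.comp (g := g') ⟨g, g2, g1⟩ h).congr (g1.comp (.refl f))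

lemma IsHEq.prodMap {f : C(X, Y)} {g : C(Z, W)} (hf : IsHEq f) (hg : IsHEq g) :
    IsHEq (f.prodMap g) := by
  obtain ⟨f', f1, f2⟩ := hf
  obtain ⟨g', g1, g2⟩ := hg
  exact ⟨f'.prodMap g', f1.prodMap g1, f2.prodMap g2⟩

/-- All maps into a contractible space are homotopic, so `f` is homotopic to a chosen equivalence.
-/
lemma isHEq_of_contractible [ContractibleSpace X] [ContractibleSpace Y] (f : C(X, Y)) :
    IsHEq f := by
  obtain ⟨e⟩ := ContractibleSpace.hequiv X Y
  obtain ⟨y, hy⟩ := (id_nullhomotopic Y).comp_left f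
  obtain ⟨y', hy'⟩ := (id_nullhomotopic Y).comp_left e.toFun
  have : IsHEq e.toFun := ⟨e.invFun, e.left_inv, e.right_inv⟩
  refine this.congr (hy'.trans (.trans ?_ hy.symm))
  obtain ⟨p⟩ := PathConnectedSpace.joined y' y
  exact ⟨⟨⟨fun q => p q.1, by fun_prop⟩, by simp, by simp⟩⟩

lemma homotopic_const_of_joined {y y' : Y} (h : Joined y y') :
    (ContinuousMap.const X y).Homotopic (.const X y') := by
  obtain ⟨p⟩ := h
  exact ⟨⟨⟨fun q => p q.1, by fun_prop⟩, by simp, by simp⟩⟩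

lemma _root_.ContinuousMap.Nullhomotopic.homotopic_const [PathConnectedSpace Y] {f : C(X, Y)} (h : f.Nullhomotopic)
    (y : Y) : f.Homotopic (.const X y) := by
  obtain ⟨y', h'⟩ := h
  exact h'.trans (homotopic_const_of_joined (PathConnectedSpace.joined y' y))

lemma isHEq_fst [ContractibleSpace Y] : IsHEq (ContinuousMap.fst : C(X × Y, X)) := by
  obtain ⟨y, hy⟩ := id_nullhomotopic Y
  refine ⟨(ContinuousMap.id X).prodMk (.const X y), ?_, by rfl⟩
  have := (Homotopic.refl (ContinuousMap.id X)).prodMap hy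
  exact this.symm

lemma isHEq_snd [ContractibleSpace Y] : IsHEq (ContinuousMap.snd : C(Y × X, X)) := by
  obtain ⟨y, hy⟩ := id_nullhomotopic Y
  refine ⟨(ContinuousMap.const X y).prodMk (.id X), ?_, by rfl⟩
  have := hy.prodMap (Homotopic.refl (ContinuousMap.id X))
  exact this.symm

end IsHEq
end PolyProd

namespace PolyProd

open Topology unitInterval

/-! ### Homotopy invariance and pasting of homotopy pushouts -/

namespace HoPushout

variable {A A' B C D : Type u} [TopologicalSpace A] [TopologicalSpace A'] [TopologicalSpace B]
  [TopologicalSpace C] [TopologicalSpace D]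

open ContinuousMap

/-- A homotopy of the left map induces a map of homotopy pushouts. -/
noncomputable def changeLeft {f f' : C(C, A)} (g : C(C, B)) (H : f.Homotopy f') :
    C(HoPushout f g, HoPushout f' g) :=
  desc (inl f' g) (inr f' g)
    (concatI ((inl f' g).comp H.toContinuousMap) (glue f' g) (by simp))
    (by simp) (by simp)

lemma changeLeft_comp_symm {f f' : C(C, A)} (g : C(C, B)) (H : f.Homotopy f') :
    ((changeLeft g H.symm).comp (changeLeft g H)).Homotopic (.id _) := by
  let G : C(ℝ × C, HoPushout f g) :=
    concat ((inl f g).comp H.symm.toContinuousMap) (glue f g) (by simp)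
  have hG0 : ∀ c, G (0, c) = inl f g (f' c) := fun c => by simp [G, concat_zero]
  have hG1 : ∀ c, G (1, c) = inl f g (f c) := fun c => by simp [G, concat_one]
  have hG2 : ∀ c, G (2, c) = inr f g (g c) := fun c => by simp [G, concat_two]
  -- On the cylinder the composite is `G` at `max (1 - 2s) (4s - 2)`, which goes from 1 back to 0
  -- and then on to 2; the identity is `G` at `1 + s`. The straight line between the two keeps the
  -- ends at 1 and 2.
  refine homotopic_of _ _ ((inl f g).comp .snd) ((inr f g).comp .snd)
    (G.comp ⟨fun p => ((1 - (p.1 : ℝ)) * max (1 - 2 * (p.2.1 : ℝ)) (4 * (p.2.1 : ℝ) - 2) +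
      (p.1 : ℝ) * (1 + p.2.1), p.2.2), by fun_prop⟩) ?_ ?_ ?_ ?_ ?_ ?_ ?_ ?_
  · intro t c
    have : (1 - (t : ℝ)) * max 1 (-2) + t = 1 := by rw [max_eq_left (by norm_num)]; ring
    simp [← hG1, this]
  · intro t c
    have : (1 - (t : ℝ)) * 2 + t * 2 = 2 := by ring
    norm_num
    rw [this, hG2]
  · intro a; rfl
  · intro a; rfl
  · intro b; rfl
  · intro b; rfl
  · intro s c
    simp only [ContinuousMap.comp_apply, ContinuousMap.coe_mk, changeLeft, desc_glue, concatI_apply]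
    simp only [Set.Icc.coe_zero, sub_zero, one_mul, zero_mul, add_zero]
    rcases le_total (s : ℝ) (1 / 2) with hs | hs
    · rw [max_eq_left (by linarith),
        concat_of_le (r := 2 * s) ⟨by have := s.2.1; linarith, by linarith⟩]
      simp only [ContinuousMap.comp_apply, desc_inl]
      simp only [G]
      rw [concat_of_le (⟨by linarith, by have := s.2.1; linarith⟩)]
      simp only [ContinuousMap.comp_apply]
      congr 1
      change H _ = H _
      congr 2
      ext
      simp
    · rw [max_eq_right (by linarith),
        concat_of_ge (r := 2 * s) ⟨by linarith, by have := s.2.2; linarith⟩]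
      simp only [desc_glue, concatI_apply, G]
      congr 2
      ring
  · intro s c
    simp only [ContinuousMap.comp_apply, ContinuousMap.coe_mk, ContinuousMap.id_apply]
    simp only [Set.Icc.coe_one, sub_self, zero_mul, one_mul, zero_add]
    exact concat_right s c

lemma isHEq_changeLeft {f f' : C(C, A)} (g : C(C, B)) (H : f.Homotopy f') :
    IsHEq (changeLeft g H) := by
  refine ⟨changeLeft g H.symm, changeLeft_comp_symm g H, ?_⟩
  have := changeLeft_comp_symm g H.symm
  rwa [Homotopy.symm_symm] at this

/-- Homotopic left maps have homotopy equivalent homotopy pushouts. -/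
lemma hEquiv_of_homotopic_left {f f' : C(C, A)} (g : C(C, B)) (h : f.Homotopic f') :
    HEquiv (HoPushout f g) (HoPushout f' g) :=
  (isHEq_changeLeft g h.some).hEquiv

/-- Interchanging the two ends. -/
def swap (f : C(C, A)) (g : C(C, B)) : C(HoPushout f g, HoPushout g f) :=
  desc (inr g f) (inl g f) ((glue g f).comp ⟨fun p => (σ p.1, p.2), by fun_prop⟩)
    (by simp) (by simp)

lemma swap_swap (f : C(C, A)) (g : C(C, B)) : (swap g f).comp (swap f g) = .id _ := by
  ext x
  induction x using cases with
  | hl a => rfl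
  | hr b => rfl
  | hg c => simp [swap]

/-- Interchanging the two ends, as a homeomorphism. -/
def swapHomeo (f : C(C, A)) (g : C(C, B)) : HoPushout f g ≃ₜ HoPushout g f where
  toFun := swap f g
  invFun := swap g f
  left_inv := DFunLike.congr_fun (swap_swap f g)
  right_inv := DFunLike.congr_fun (swap_swap g f)

lemma hEquiv_swap (f : C(C, A)) (g : C(C, B)) : HEquiv (HoPushout f g) (HoPushout g f) :=
  (swapHomeo f g).hEquiv

lemma hEquiv_of_homotopic_right (f : C(C, A)) {g g' : C(C, B)} (h : g.Homotopic g') :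
    HEquiv (HoPushout f g) (HoPushout f g') :=
  (hEquiv_swap f g).trans ((hEquiv_of_homotopic_left f h).trans (hEquiv_swap g' f))

/-- A map of the left end induces a map of homotopy pushouts. -/
def mapLeft (f : C(C, A)) (g : C(C, B)) (α : C(A, A')) :
    C(HoPushout f g, HoPushout (α.comp f) g) :=
  desc ((inl _ g).comp α) (inr _ g) (glue _ g) (by simp) (by simp)

/-- Followed by `changeLeft`, the map is `G` at `2s` on the cylinder, while the identity is `G` at
`1 + s`. The straight line between them has value `t` at `s = 0`, so it moves the left end along
`U`. -/
lemma isHEq_mapLeft_self (f : C(C, A)) (g : C(C, B)) {α : C(A, A)} (h : α.Homotopic (.id A)) :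
    IsHEq (mapLeft f g α) := by
  obtain ⟨U⟩ := h
  let H : (α.comp f).Homotopy f := ⟨⟨fun p => U (p.1, f p.2), by fun_prop⟩, by simp, by simp⟩
  refine IsHEq.of_comp_left (isHEq_changeLeft g H) (isHEq_id.congr (Homotopic.symm ?_))
  let G : C(ℝ × C, HoPushout f g) := concat ((inl f g).comp H.toContinuousMap) (glue f g) (by simp)
  have hG2 : ∀ c, G (2, c) = inr f g (g c) := fun c => by simp [G, concat_two]
  refine homotopic_of _ _ ((inl f g).comp U.toContinuousMap) ((inr f g).comp .snd)
    (G.comp ⟨fun p => ((1 - (p.1 : ℝ)) * (2 * p.2.1) +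
      (p.1 : ℝ) * (1 + p.2.1), p.2.2), by fun_prop⟩) ?_ ?_ ?_ ?_ ?_ ?_ ?_ ?_
  · intro t c
    simp only [ContinuousMap.comp_apply, ContinuousMap.coe_mk]
    simp only [Set.Icc.coe_zero, mul_zero, add_zero, mul_one, zero_add, G, concat_left]
    rfl
  · intro t c
    simp only [ContinuousMap.comp_apply, ContinuousMap.coe_mk]
    have : (1 - (t : ℝ)) * (2 * (1 : I)) + t * (1 + (1 : I)) = 2 := by
      simp only [Set.Icc.coe_one]; ring
    rw [this, hG2]
    rfl
  · intro a
    simp [mapLeft, changeLeft]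
  · intro a
    simp
  · intro b; rfl
  · intro b; rfl
  · intro s c
    simp [mapLeft, changeLeft, concatI_apply, G]
  · intro s c
    simp only [ContinuousMap.comp_apply, ContinuousMap.coe_mk, ContinuousMap.id_apply]
    simp only [Set.Icc.coe_one, sub_self, zero_mul, one_mul, zero_add]
    exact concat_right s c

/-- Two out of six for `α`, `β`, `α`: both composites are induced by self-maps homotopic to the
identity. -/
lemma isHEq_mapLeft (f : C(C, A)) (g : C(C, B)) {α : C(A, A')} (h : IsHEq α) :
    IsHEq (mapLeft f g α) := by
  obtain ⟨β, h1, h2⟩ := h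
  refine IsHEq.of_two_of_six (g := mapLeft (α.comp f) g β)
    (k := mapLeft (β.comp (α.comp f)) g α) ?_ ?_
  · have : (mapLeft (α.comp f) g β).comp (mapLeft f g α) = mapLeft f g (β.comp α) := by
      ext x
      induction x using cases <;> rfl
    rw [this]
    exact isHEq_mapLeft_self f g h1
  · have : (mapLeft (β.comp (α.comp f)) g α).comp (mapLeft (α.comp f) g β) =
        mapLeft (α.comp f) g (α.comp β) := by
      ext x
      induction x using cases <;> rfl
    rw [this]
    exact isHEq_mapLeft_self _ g h2

lemma hEquiv_mapLeft (f : C(C, A)) (g : C(C, B)) {α : C(A, A')} (h : IsHEq α) :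
    HEquiv (HoPushout f g) (HoPushout (α.comp f) g) := (isHEq_mapLeft f g h).hEquiv

lemma hEquiv_mapRight (g : C(C, B)) (f : C(C, A)) {α : C(A, A')} (h : IsHEq α) :
    HEquiv (HoPushout g f) (HoPushout g (α.comp f)) :=
  (hEquiv_swap g f).trans ((hEquiv_mapLeft f g h).trans (hEquiv_swap _ _))

/-- A map into the middle term induces a map of homotopy pushouts. -/
def mapMid (f : C(C, A)) (g : C(C, B)) (γ : C(D, C)) :
    C(HoPushout (f.comp γ) (g.comp γ), HoPushout f g) :=
  desc (inl f g) (inr f g) ((glue f g).comp ((ContinuousMap.id I).prodMap γ)) (by simp) (by simp)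

/-- A homotopy of the right map induces a map of homotopy pushouts. -/
noncomputable def changeRight (f : C(C, A)) {g g' : C(C, B)} (H : g.Homotopy g') :
    C(HoPushout f g, HoPushout f g') :=
  (swap g' f).comp ((changeLeft f H).comp (swap f g))

lemma isHEq_changeRight (f : C(C, A)) {g g' : C(C, B)} (H : g.Homotopy g') :
    IsHEq (changeRight f H) :=
  (swapHomeo g' f).isHEq.comp ((isHEq_changeLeft f H).comp (swapHomeo f g).isHEq)

lemma isHEq_mapMid_self (f : C(C, A)) (g : C(C, B)) {γ : C(C, C)} (h : γ.Homotopic (.id C)) :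
    IsHEq (mapMid f g γ) := by
  obtain ⟨U⟩ := h
  let HA : (f.comp γ).Homotopy f := ⟨⟨fun p => f (U p), by fun_prop⟩, by simp, by simp⟩
  let HB : (g.comp γ).Homotopy g := ⟨⟨fun p => g (U p), by fun_prop⟩, by simp, by simp⟩
  refine ((isHEq_changeRight f HB).comp (isHEq_changeLeft (g.comp γ) HA)).congr
    (Homotopic.symm ?_)
  -- `wB` is the cylinder coordinate and `wA` the time in `U`. At `t = 0` the path `(wB, wA)` runs
  -- along the edge `wA = 0` of the square, at `t = 1` along the other three edges. The corners at
  -- `s = 1/2` and `s = 3/4` come from the nested `concatI`.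
  let wA : C(I × I, I) := ⟨fun p => Set.projIcc 0 1 zero_le_one
    ((p.1 : ℝ) * min (min (2 * (p.2 : ℝ)) (4 - 4 * p.2)) 1), by fun_prop⟩
  let wB : C(I × I, I) := ⟨fun p => Set.projIcc 0 1 zero_le_one
    ((1 - (p.1 : ℝ)) * p.2 + (p.1 : ℝ) * min (max (4 * (p.2 : ℝ) - 2) 0) 1), by fun_prop⟩
  refine homotopic_of _ _ ((inl f g).comp .snd) ((inr f g).comp .snd)
    ((glue f g).comp ⟨fun p => (wB (p.1, p.2.1), U (wA (p.1, p.2.1), p.2.2)), by fun_prop⟩)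
    ?_ ?_ ?_ ?_ ?_ ?_ ?_ ?_
  · intro t c
    have h1 : wA (t, 0) = 0 := by simp [wA]
    have h2 : wB (t, 0) = 0 := by simp [wB]
    simp [h1, h2]
  · intro t c
    have h1 : wA (t, 1) = 0 := by simp [wA]
    have h2 : wB (t, 1) = 1 := by norm_num [wB]
    simp [h1, h2]
  · intro a; rfl
  · intro a; rfl
  · intro b; rfl
  · intro b; rfl
  · intro s c
    have h1 : wA (0, s) = 0 := by simp [wA]
    have h2 : wB (0, s) = s := by simp [wB]
    simp [h1, h2, mapMid]
  · intro s c
    simp only [ContinuousMap.comp_apply, ContinuousMap.coe_mk, changeLeft, desc_glue, concatI_apply]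
    rcases le_total (s : ℝ) (1 / 2) with hs | hs
    · rw [concat_of_le (⟨by have := s.2.1; linarith, by linarith⟩)]
      have h1 : wA (1, s) = ⟨2 * s, by have := s.2.1; linarith, by linarith⟩ := by
        ext
        simp only [wA, ContinuousMap.coe_mk, Set.Icc.coe_one, one_mul]
        rw [min_eq_left (b := 4 - 4 * (s : ℝ)) (by linarith [s.2.1]),
          min_eq_left (by linarith [s.2.1]), Set.projIcc_of_mem]
        exact ⟨by linarith [s.2.1], by linarith⟩
      have h2 : wB (1, s) = 0 := by
        simp only [wB, ContinuousMap.coe_mk, Set.Icc.coe_one, one_mul]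
        rw [max_eq_right (by linarith [s.2.1])]
        simp
      rw [h1, h2, glue_zero]
      rfl
    · rw [concat_of_ge (⟨by linarith, by have := s.2.2; linarith⟩)]
      simp only [changeRight, ContinuousMap.comp_apply, swap, desc_glue, changeLeft,
        ContinuousMap.coe_mk, concatI_apply, unitInterval.coe_symm_eq]
      rcases le_total (s : ℝ) (3 / 4) with hs' | hs'
      · rw [concat_of_ge (⟨by linarith, by linarith⟩)]
        have h1 : wA (1, s) = 1 := by
          simp only [wA, ContinuousMap.coe_mk, Set.Icc.coe_one, one_mul]
          rw [min_eq_right (le_min (by linarith) (by linarith))]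
          simp
        have h2 : wB (1, s) = ⟨4 * s - 2, by linarith, by linarith⟩ := by
          ext
          simp only [wB, ContinuousMap.coe_mk, Set.Icc.coe_one, one_mul]
          rw [max_eq_left (by linarith [s.2.1]), min_eq_left (by linarith)]
          rw [sub_self, zero_mul, zero_add, Set.projIcc_of_mem]
          exact ⟨by linarith, by linarith⟩
        rw [h1, h2]
        simp only [desc_glue, ContinuousMap.comp_apply, Homotopy.apply_one, ContinuousMap.coe_mk]
        congr 2
        ext
        simp
        ring
      · rw [concat_of_le (⟨by linarith [s.2.2], by linarith⟩)]
        have h1 : wA (1, s) = ⟨4 - 4 * s, by linarith [s.2.2], by linarith⟩ := by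
          ext
          simp only [wA, ContinuousMap.coe_mk, Set.Icc.coe_one, one_mul]
          rw [min_eq_right (b := 4 - 4 * (s : ℝ)) (by linarith [s.2.1]),
            min_eq_left (by linarith [s.2.1]), Set.projIcc_of_mem]
          exact ⟨by linarith [s.2.2], by linarith⟩
        have h2 : wB (1, s) = 1 := by
          simp only [wB, ContinuousMap.coe_mk, Set.Icc.coe_one, one_mul]
          rw [max_eq_left (by linarith [s.2.1]), min_eq_right (by linarith)]
          simp
        rw [h1, h2, glue_one]
        simp only [ContinuousMap.comp_apply, desc_inl]
        congr 1
        change g (U _) = g (U _)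
        congr 3
        ext
        simp
        ring

/-- The map induced by `δ` is the inner factor of one equivalence and the outer factor of another.
Hence it is an equivalence itself, and cancelling it leaves `mapMid f g γ`. -/
lemma isHEq_mapMid (f : C(C, A)) (g : C(C, B)) {γ : C(D, C)} (h : IsHEq γ) :
    IsHEq (mapMid f g γ) := by
  obtain ⟨δ, h1, h2⟩ := h
  have e1 : (mapMid f g γ).comp (mapMid (f.comp γ) (g.comp γ) δ) = mapMid f g (γ.comp δ) := by
    ext x
    induction x using cases <;> rfl
  have e2 : (mapMid (f.comp γ) (g.comp γ) δ).comp
      (mapMid ((f.comp γ).comp δ) ((g.comp γ).comp δ) γ) =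
      mapMid (f.comp γ) (g.comp γ) (δ.comp γ) := by
    ext x
    induction x using cases <;> rfl
  have i1 := isHEq_mapMid_self f g h2
  have i2 := isHEq_mapMid_self (f.comp γ) (g.comp γ) h1
  rw [← e1] at i1
  rw [← e2] at i2
  obtain ⟨a, a1, a2⟩ := i1
  obtain ⟨b, b1, b2⟩ := i2
  have hδ : IsHEq (mapMid (f.comp γ) (g.comp γ) δ) :=
    IsHEq.of_left_right (g := a.comp (mapMid f g γ))
      (g' := (mapMid ((f.comp γ).comp δ) ((g.comp γ).comp δ) γ).comp b) a1 b2
  obtain ⟨δ', d1, d2⟩ := hδ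
  have h3 : IsHEq (((mapMid f g γ).comp (mapMid (f.comp γ) (g.comp γ) δ)).comp δ') :=
    IsHEq.comp ⟨a, a1, a2⟩ ⟨_, d2, d1⟩
  exact h3.congr ((Homotopic.refl (mapMid f g γ)).comp d2)

lemma hEquiv_mapMid (f : C(C, A)) (g : C(C, B)) {γ : C(D, C)} (h : IsHEq γ) :
    HEquiv (HoPushout (f.comp γ) (g.comp γ)) (HoPushout f g) := (isHEq_mapMid f g h).hEquiv

/-- Pasting of homotopy pushouts. -/
lemma hEquiv_paste (f : C(C, A)) (g : C(C, B)) (k : C(A, A')) :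
    HEquiv (HoPushout (k.comp f) g) (HoPushout k (inl f g)) := by
  -- `Φ` collapses the outer cylinder, over `A`, onto the end `A'`. Its inverse `Ψ` runs through the
  -- outer cylinder over `f c` and then through the inner one.
  let Φ : C(HoPushout k (inl f g), HoPushout (k.comp f) g) :=
    desc (inl _ _) (mapLeft f g k) (((inl (k.comp f) g).comp k).comp .snd) (by simp)
      (by simp [mapLeft])
  let G : C(ℝ × C, HoPushout k (inl f g)) :=
    concat ((glue k (inl f g)).comp ((ContinuousMap.id I).prodMap f))
      ((inr k (inl f g)).comp (glue f g)) (by simp)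
  let Ψ : C(HoPushout (k.comp f) g, HoPushout k (inl f g)) :=
    desc (inl _ _) ((inr _ _).comp (inr _ _))
      (concatI ((glue k (inl f g)).comp ((ContinuousMap.id I).prodMap f))
      ((inr k (inl f g)).comp (glue f g)) (by simp)) (by simp) (by simp)
  refine IsHEq.hEquiv (f := Ψ) ⟨Φ, ?_, ?_⟩
  · let K : C(ℝ × C, HoPushout (k.comp f) g) :=
      concat (((inl (k.comp f) g).comp (k.comp f)).comp .snd) (glue _ _) (by simp)
    have hK : ∀ r c, Φ (G (r, c)) = K (r, c) := by
      intro r c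
      simp only [G, K, concat, ContinuousMap.coe_mk, apply_ite Φ]
      rfl
    refine homotopic_of _ _ ((inl (k.comp f) g).comp .snd) ((inr (k.comp f) g).comp .snd)
      (K.comp ⟨fun p => ((1 - (p.1 : ℝ)) * (2 * p.2.1) +
      (p.1 : ℝ) * (1 + p.2.1), p.2.2), by fun_prop⟩) ?_ ?_ ?_ ?_ ?_ ?_ ?_ ?_
    · intro t c
      simp only [ContinuousMap.comp_apply, ContinuousMap.coe_mk]
      simp only [Set.Icc.coe_zero, mul_zero, add_zero, mul_one, zero_add, K, concat_left]
      rfl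
    · intro t c
      simp only [ContinuousMap.comp_apply, ContinuousMap.coe_mk]
      have : (1 - (t : ℝ)) * (2 * (1 : I)) + t * (1 + (1 : I)) = 2 := by
        simp only [Set.Icc.coe_one]; ring
      rw [this, concat_two, glue_one]
      rfl
    · intro a; rfl
    · intro a; rfl
    · intro b; rfl
    · intro b; rfl
    · intro s c
      simp only [ContinuousMap.comp_apply, ContinuousMap.coe_mk]
      simp only [Set.Icc.coe_zero, sub_zero, one_mul, zero_mul, add_zero, ← hK]
      rfl
    · intro s c
      simp only [ContinuousMap.comp_apply, ContinuousMap.coe_mk, ContinuousMap.id_apply]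
      simp only [Set.Icc.coe_one, sub_self, zero_mul, one_mul, zero_add]
      exact concat_right s c
  · -- the homotopy on the right end
    let R : C(HoPushout f g, C(I, HoPushout k (inl f g))) :=
      desc ((glue k (inl f g)).comp prodSwap).curry
        ((((inr k (inl f g)).comp (inr f g)).comp .snd).comp prodSwap).curry
        ((G.comp ⟨fun p => ((1 - (p.1 : ℝ)) * (2 * p.2.1) +
          (p.1 : ℝ) * (1 + p.2.1), p.2.2), by fun_prop⟩).comp prodSwap).curry
        (by
          intro c; ext t
          simp [G, concat_left])
        (by
          intro c; ext t
          have : (1 - (t : ℝ)) * 2 + t * 2 = 2 := by ring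
          norm_num
          rw [this]
          simp [G, concat_two])
    refine homotopic_of _ _ ((inl _ _).comp .snd) (R.uncurry.comp prodSwap)
      ((glue k (inl f g)).comp ⟨fun p => (p.1 * p.2.1, p.2.2), by fun_prop⟩) ?_ ?_ ?_ ?_ ?_ ?_ ?_ ?_
    · intro t a; simp
    · intro t a
      simp [R]
    · intro a; rfl
    · intro a; rfl
    · intro x
      induction x using cases with
      | hl a => simp [R, Φ, Ψ, mapLeft]
      | hr b => simp [R, Φ, Ψ, mapLeft]
      | hg c => simp [R, Φ, Ψ, mapLeft, ← concatI_apply, G]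
    · intro x
      induction x using cases with
      | hl a => simp [R]
      | hr b => simp [R]
      | hg c =>
        simp only [R, G, ContinuousMap.comp_apply, uncurry_apply, prodSwap_apply, id_apply]
        change G ((1 - ((1 : I) : ℝ)) * (2 * c.1) + ((1 : I) : ℝ) * (1 + c.1), c.2) = _
        simp only [Set.Icc.coe_one, sub_self, zero_mul, one_mul, zero_add]
        exact concat_right _ _
    · intro s a
      simp [Φ, Ψ]
    · intro s a
      simp

end HoPushout
end PolyProd

namespace PolyProd

open Topology unitInterval

open ContinuousMap

/-! ### Topological pushouts along cofibrations -/

section Gluing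

variable {A B C X D : Type u} [TopologicalSpace A] [TopologicalSpace B] [TopologicalSpace C]
  [TopologicalSpace X] [TopologicalSpace D]

/-- The square formed by `f`, `g`, `p`, `q` is a pushout of topological spaces. -/
structure IsTopPushout (f : C(C, A)) (g : C(C, B)) (p : C(A, X)) (q : C(B, X)) : Prop where
  comm : ∀ c, p (f c) = q (g c)
  surj : ∀ x, (∃ a, p a = x) ∨ ∃ b, q b = x
  desc : ∀ (Z : Type u) [TopologicalSpace Z] (a : C(A, Z)) (b : C(B, Z)),
    (∀ c, a (f c) = b (g c)) → ∃ d : C(X, Z), (∀ x, d (p x) = a x) ∧ ∀ x, d (q x) = b x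

/-- The homotopy extension property of a map. -/
def HEP (g : C(C, B)) : Prop :=
  ∀ (Z : Type u) [TopologicalSpace Z] (φ : C(B, Z)) (H : C(I × C, Z)),
    (∀ c, H (0, c) = φ (g c)) → ∃ E : C(I × B, Z), (∀ b, E (0, b) = φ b) ∧
      ∀ t c, E (t, g c) = H (t, c)

lemma HEP.id : HEP (ContinuousMap.id C) := fun _ _ _ H h => ⟨H, h, fun _ _ => rfl⟩

lemma HEP.of_homeo {C' B' : Type u} [TopologicalSpace C'] [TopologicalSpace B'] {g : C(C, B)}
    (hg : HEP g) (eC : C' ≃ₜ C) (eB : B ≃ₜ B') (g' : C(C', B'))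
    (h : ∀ c, g' c = eB (g (eC c))) : HEP g' := by
  intro Z _ φ H hH
  obtain ⟨E, E0, E1⟩ := hg Z (φ.comp eB)
    (H.comp ((ContinuousMap.id I).prodMap (eC.symm : C(C, C')))) (by
      intro c
      simp [hH, h])
  refine ⟨E.comp ((ContinuousMap.id I).prodMap (eB.symm : C(B', B))), fun b => ?_, fun t c => ?_⟩
  · simp [E0]
  · simp [h, E1]

/-- In terms of maps into `C(I, Z)`, the extension over `B` and the given homotopy on `A` glue by
the universal property. -/
lemma IsTopPushout.hep {f : C(C, A)} {g : C(C, B)} {p : C(A, X)} {q : C(B, X)}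
    (h : IsTopPushout f g p q) (hg : HEP g) : HEP p := by
  intro Z _ φ H hH
  obtain ⟨E, E0, E1⟩ := hg Z (φ.comp q) (H.comp ((ContinuousMap.id I).prodMap f)) (by
    intro c
    simp [hH, h.comm])
  obtain ⟨d, d1, d2⟩ := h.desc C(I, Z) (H.comp prodSwap).curry (E.comp prodSwap).curry (by
    intro c
    ext t
    simp [E1])
  refine ⟨d.uncurry.comp prodSwap, fun x => ?_, fun t c => ?_⟩
  · rcases h.surj x with ⟨a, rfl⟩ | ⟨b, rfl⟩
    · simp [d1, hH]
    · simp [d2, E0]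
  · simp [d1]

/-- A topological pushout along a map with the homotopy extension property is a homotopy
pushout. -/
lemma IsTopPushout.exists_isHEq {f : C(C, A)} {g : C(C, B)} {p : C(A, X)} {q : C(B, X)}
    (h : IsTopPushout f g p q) (hg : HEP g) :
    ∃ π : C(HoPushout f g, X), IsHEq π ∧ (∀ a, π (HoPushout.inl f g a) = p a) ∧
      ∀ b, π (HoPushout.inr f g b) = q b := by
  let π : C(HoPushout f g, X) :=
    HoPushout.desc p q ((p.comp f).comp .snd) (by simp) (by simp [h.comm])
  -- `E` pushes the right end back along the reversed cylinder. At time 1 it sends `g c` to the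
  -- point `f c` of the left end, so it glues with `inl` to an inverse of `π`.
  obtain ⟨E, E0, E1⟩ := hg _ (HoPushout.inr f g)
    ((HoPushout.glue f g).comp ⟨fun x => (σ x.1, x.2), by fun_prop⟩) (by simp)
  obtain ⟨ρ, r1, r2⟩ := h.desc _ (HoPushout.inl f g) (E.comp ⟨fun b => (1, b), by fun_prop⟩) (by
    intro c
    simp [E1])
  refine ⟨π, ⟨ρ, Homotopic.symm ?_, Homotopic.symm ?_⟩, fun _ => rfl, fun _ => rfl⟩
  · refine HoPushout.homotopic_of _ _ ((HoPushout.inl f g).comp .snd) E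
      ((HoPushout.glue f g).comp ⟨fun x => (x.2.1 * σ x.1, x.2.2), by fun_prop⟩)
      ?_ ?_ ?_ ?_ ?_ ?_ ?_ ?_
    · intro t c; simp
    · intro t c; simp [E1]
    · intro a; rfl
    · intro a; simp [π, r1]
    · intro b; simp [E0]
    · intro b; simp [π, r2]
    · intro s c; simp
    · intro s c; simp [π, r1]
  · obtain ⟨d, d1, d2⟩ := h.desc C(I, X) (p.comp .fst).curry ((π.comp E).comp prodSwap).curry (by
      intro c
      ext t
      simp [E1, π])
    refine ⟨⟨d.uncurry.comp prodSwap, fun x => ?_, fun x => ?_⟩⟩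
    · rcases h.surj x with ⟨a, rfl⟩ | ⟨b, rfl⟩
      · simp [d1]
      · simp [d2, E0, π]
    · rcases h.surj x with ⟨a, rfl⟩ | ⟨b, rfl⟩
      · simp [d1, r1, π]
      · simp [d2, r2]

lemma IsTopPushout.hEquiv {f : C(C, A)} {g : C(C, B)} {p : C(A, X)} {q : C(B, X)}
    (h : IsTopPushout f g p q) (hg : HEP g) : HEquiv (HoPushout f g) X :=
  (h.exists_isHEq hg).choose_spec.1.hEquiv

/-- Currying turns a map out of the product into a map to `C(S, Z)`; local compactness of `S` allows
going back. -/
lemma IsTopPushout.prod {f : C(C, A)} {g : C(C, B)} {p : C(A, X)} {q : C(B, X)}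
    (h : IsTopPushout f g p q) (S : Type u) [TopologicalSpace S] [LocallyCompactSpace S] :
    IsTopPushout (f.prodMap (.id S)) (g.prodMap (.id S)) (p.prodMap (.id S))
      (q.prodMap (.id S)) where
  comm := fun c => Prod.ext (h.comm c.1) rfl
  surj := by
    rintro ⟨x, s⟩
    rcases h.surj x with ⟨a, rfl⟩ | ⟨b, rfl⟩
    · exact Or.inl ⟨(a, s), rfl⟩
    · exact Or.inr ⟨(b, s), rfl⟩
  desc := by
    intro Z _ a b hab
    obtain ⟨d, d1, d2⟩ := h.desc C(S, Z) a.curry b.curry (by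
      intro c
      ext s
      exact hab (c, s))
    refine ⟨d.uncurry, fun x => ?_, fun x => ?_⟩
    · exact DFunLike.congr_fun (d1 x.1) x.2
    · exact DFunLike.congr_fun (d2 x.1) x.2

/-- A map from a compact to a Hausdorff space is closed, so `A ⊕ B → X` is a quotient map; the last
three hypotheses say that it identifies no more than the gluing forces. -/
lemma IsTopPushout.of_compact [CompactSpace A] [CompactSpace B] [T2Space X] {f : C(C, A)}
    {g : C(C, B)} {p : C(A, X)} {q : C(B, X)} (comm : ∀ c, p (f c) = q (g c))
    (surj : ∀ x, (∃ a, p a = x) ∨ ∃ b, q b = x) (hp : Function.Injective p)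
    (hq : ∀ b b', q b = q b' → b = b' ∨ ∃ c c', g c = b ∧ g c' = b' ∧ f c = f c')
    (hpq : ∀ a b, p a = q b → ∃ c, f c = a ∧ g c = b) : IsTopPushout f g p q where
  comm := comm
  surj := surj
  desc := by
    intro Z _ a b hab
    have hc : Continuous (Sum.elim p q) := by fun_prop
    have hs : Function.Surjective (Sum.elim p q) := by
      intro x
      rcases surj x with ⟨a, rfl⟩ | ⟨b, rfl⟩
      · exact ⟨Sum.inl a, rfl⟩
      · exact ⟨Sum.inr b, rfl⟩
    have hQ : IsQuotientMap (Sum.elim p q) := hc.isClosedMap.isQuotientMap hc hs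
    let e : C(A ⊕ B, Z) := ⟨Sum.elim a b, by fun_prop⟩
    have he : Function.FactorsThrough e (⟨Sum.elim p q, hc⟩ : C(A ⊕ B, X)) := by
      have key : ∀ x y, p x = q y → a x = b y := by
        intro x y h
        obtain ⟨c, rfl, rfl⟩ := hpq x y h
        exact hab c
      rintro (x | x) (y | y) h
      · exact congrArg a (hp h)
      · exact key x y h
      · exact (key y x h.symm).symm
      · rcases hq x y h with h | ⟨c, c', rfl, rfl, hf⟩
        · exact congrArg b h
        · change b _ = b _
          rw [← hab, ← hab, hf]
    refine ⟨IsQuotientMap.lift (f := ⟨Sum.elim p q, hc⟩) hQ e he, fun x => ?_, fun x => ?_⟩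
    · exact DFunLike.congr_fun (IsQuotientMap.lift_comp (f := ⟨Sum.elim p q, hc⟩) hQ e he)
        (Sum.inl x)
    · exact DFunLike.congr_fun (IsQuotientMap.lift_comp (f := ⟨Sum.elim p q, hc⟩) hQ e he)
        (Sum.inr x)

/-- A homotopy pushout along an identity map is equivalent to the other end. -/
lemma HoPushout.hEquiv_id (g : C(C, B)) : HEquiv (HoPushout (.id C) g) B := by
  refine (HoPushout.hEquiv_swap _ _).trans (IsTopPushout.hEquiv (p := .id B) (q := g) ?_ HEP.id)
  exact ⟨fun _ => rfl, fun x => Or.inl ⟨x, rfl⟩, fun Z _ a b h => ⟨a, fun _ => rfl, h⟩⟩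

lemma HoPushout.hEquiv_of_isHEq {f : C(C, A)} (hf : IsHEq f) (g : C(C, B)) :
    HEquiv (HoPushout f g) B :=
  ((HoPushout.hEquiv_mapLeft (.id C) g hf).symm).trans (HoPushout.hEquiv_id g)

/-- Homotopy pushouts commute with products with locally compact spaces. -/
lemma HoPushout.exists_isHEq_prod (f : C(C, A)) (g : C(C, B)) (S : Type u) [TopologicalSpace S]
    [LocallyCompactSpace S] :
    ∃ π : C(HoPushout (f.prodMap (.id S)) (g.prodMap (.id S)), HoPushout f g × S), IsHEq π ∧
      ∀ x, π (HoPushout.inl _ _ x) = (HoPushout.inl _ _ x.1, x.2) := by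
  let π : C(HoPushout (f.prodMap (.id S)) (g.prodMap (.id S)), HoPushout f g × S) :=
    HoPushout.desc ((HoPushout.inl f g).prodMap (.id S)) ((HoPushout.inr f g).prodMap (.id S))
      ⟨fun x => (HoPushout.glue f g (x.1, x.2.1), x.2.2), by fun_prop⟩ (by simp) (by simp)
  let ρ : C(HoPushout f g, C(S, HoPushout (f.prodMap (.id S)) (g.prodMap (.id S)))) :=
    HoPushout.desc (HoPushout.inl _ _).curry (HoPushout.inr _ _).curry
      (ContinuousMap.curry ⟨fun x : (I × C) × S => HoPushout.glue _ _ (x.1.1, (x.1.2, x.2)),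
        by fun_prop⟩)
      (by intro c; ext s; simp) (by intro c; ext s; simp)
  refine ⟨π, ⟨ρ.uncurry, ?_, ?_⟩, fun _ => rfl⟩
  · rw [show ρ.uncurry.comp π = .id _ from ?_]
    ext x
    induction x using HoPushout.cases <;> rfl
  · rw [show π.comp ρ.uncurry = .id _ from ?_]
    ext x : 1
    obtain ⟨x, s⟩ := x
    induction x using HoPushout.cases <;> rfl

/-- The left end of the homotopy pushout of the two projections of a product is contracted. -/
lemma HoPushout.inl_nullhomotopic {S : Type u} [TopologicalSpace S] (f : C(C, A)) (g : C(C, B))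
    (k : C(S, A)) (j : C(S, C)) (b : B) (hf : ∀ s, f (j s) = k s) (hg : ∀ s, g (j s) = b) :
    ((HoPushout.inl f g).comp k).Homotopic (.const S (HoPushout.inr f g b)) :=
  ⟨⟨(HoPushout.glue f g).comp ((ContinuousMap.id I).prodMap j), by simp [hf], by simp [hg]⟩⟩

/-- Continuous maps on two closed sets that cover the space glue. -/
lemma exists_glue_closed {Z : Type*} [TopologicalSpace Z] {F G : Set X} (hF : IsClosed F)
    (hG : IsClosed G) (hFG : F ∪ G = Set.univ) (f : C(F, Z)) (g : C(G, Z))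
    (h : ∀ x (hx : x ∈ F) (hx' : x ∈ G), f ⟨x, hx⟩ = g ⟨x, hx'⟩) :
    ∃ d : C(X, Z), (∀ x : F, d x = f x) ∧ ∀ x : G, d x = g x := by
  classical
  have hm : ∀ x, x ∉ F → x ∈ G := fun x hx =>
    (show x ∈ F ∪ G by rw [hFG]; trivial).resolve_left hx
  let d : X → Z := fun x => if hx : x ∈ F then f ⟨x, hx⟩ else g ⟨x, hm x hx⟩
  have d1 : ∀ x : F, d x = f x := fun x => by simp [d]
  have d2 : ∀ x : G, d x = g x := fun x => by
    by_cases hx : (x : X) ∈ F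
    · simp [d, hx, h x hx x.2]
    · simp [d, hx]
  refine ⟨⟨d, ?_⟩, d1, d2⟩
  rw [← continuousOn_univ, ← hFG]
  refine ContinuousOn.union_of_isClosed ?_ ?_ hF hG
  · rw [continuousOn_iff_continuous_domRestrict]
    exact f.continuous.congr fun x => (d1 x).symm
  · rw [continuousOn_iff_continuous_domRestrict]
    exact g.continuous.congr fun x => (d2 x).symm

end Gluing

/-! ### Cofibrations from retractions of the cylinder -/

section NDR

variable {Y D : Type u} [TopologicalSpace Y] [TopologicalSpace D]

/-- The set `A` is closed in `Y`, and the cylinder `I × Y` retracts onto `0 × Y ∪ I × A`. -/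
structure IsNDR (A : Set Y) : Prop where
  isClosed : IsClosed A
  exists_retraction : ∃ (R : C(I × Y, Y)) (τ : C(I × Y, I)), (∀ y, R (0, y) = y) ∧
    (∀ y, τ (0, y) = 0) ∧ (∀ t, ∀ a ∈ A, R (t, a) = a ∧ τ (t, a) = t) ∧
    ∀ p, τ p = 0 ∨ R p ∈ A

/-- The inclusion of a subset, as a continuous map. -/
def incl (A : Set Y) : C(A, Y) := ⟨Subtype.val, continuous_subtype_val⟩

@[simp] lemma incl_apply (A : Set Y) (a : A) : incl A a = a := rfl

/-- The extension is `φ ∘ R` where `τ = 0` and `H ∘ (τ, R)` where `R` lies in `A`; these two closed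
sets cover the cylinder. The factor `D` is merely carried along. -/
lemma IsNDR.hep_prod {A : Set Y} (h : IsNDR A) (D : Type u) [TopologicalSpace D] :
    HEP ((incl A).prodMap (.id D)) := by
  obtain ⟨R, τ, R0, τ0, ha, hp⟩ := h.exists_retraction
  intro Z _ φ H hH
  let F : Set (I × Y × D) := {x | τ (x.1, x.2.1) = 0}
  let G : Set (I × Y × D) := {x | R (x.1, x.2.1) ∈ A}
  have hF : IsClosed F := isClosed_eq (by fun_prop) continuous_const
  have hG : IsClosed G := h.isClosed.preimage
    (f := fun x : I × Y × D => R (x.1, x.2.1)) (by fun_prop)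
  obtain ⟨d, d1, d2⟩ := exists_glue_closed hF hG
    (Set.eq_univ_of_forall fun x => hp (x.1, x.2.1))
    ⟨fun x => φ (R (x.1.1, x.1.2.1), x.1.2.2), by fun_prop⟩
    ⟨fun x => H (τ (x.1.1, x.1.2.1), (⟨R (x.1.1, x.1.2.1), x.2⟩, x.1.2.2)), by fun_prop⟩ (by
      rintro ⟨t, y, b⟩ hx hx'
      change φ _ = H (τ (t, y), _)
      rw [show τ (t, y) = 0 from hx, hH]
      rfl)
  refine ⟨d, ?_, ?_⟩
  · rintro ⟨y, b⟩
    refine (d1 ⟨(0, (y, b)), τ0 y⟩).trans ?_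
    simp [R0]
  · rintro t ⟨a, b⟩
    have := ha t a a.2
    refine (d2 ⟨(t, (a, b)), by simp [G, this]⟩).trans ?_
    simp [this]

lemma IsNDR.hep_prod' {A : Set Y} (h : IsNDR A) (D : Type u) [TopologicalSpace D] :
    HEP ((ContinuousMap.id D).prodMap (incl A)) :=
  (h.hep_prod D).of_homeo (Homeomorph.prodComm _ _) (Homeomorph.prodComm _ _) _ fun _ => rfl

lemma IsNDR.hep {A : Set Y} (h : IsNDR A) : HEP (incl A) :=
  (h.hep_prod PUnit.{u + 1}).of_homeo (Homeomorph.prodPUnit _).symm (Homeomorph.prodPUnit _) _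
    fun _ => rfl

end NDR
end PolyProd

namespace PolyProd

open Topology

open ContinuousMap

/-! ### The space `Z × A ∪ B × Y` as a homotopy pushout -/

section Attach

variable {P Y : Type u} [TopologicalSpace P] [TopologicalSpace Y]

/-- The subspace `Z × A ∪ B × Y` of `P × Y`. -/
def attach (Z B : Set P) (A : Set Y) : Set (P × Y) := {x | (x.1 ∈ Z ∧ x.2 ∈ A) ∨ x.1 ∈ B}

variable {Z B : Set P} {A : Set Y}

/-- The inclusion of a set into a larger one, as a continuous map. -/
def inclOf (h : B ⊆ Z) : C(B, Z) := ⟨Set.inclusion h, continuous_inclusion h⟩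

@[simp] lemma coe_inclOf (h : B ⊆ Z) (b : B) : (inclOf h b : P) = b := rfl

lemma attach_isTopPushout (h : B ⊆ Z) (hB : IsClosed B) (hA : IsClosed A) :
    IsTopPushout ((inclOf h).prodMap (.id A)) ((ContinuousMap.id B).prodMap (incl A))
      (⟨fun x => ⟨(x.1, x.2), Or.inl ⟨x.1.2, x.2.2⟩⟩, by fun_prop⟩ : C(Z × A, attach Z B A))
      (⟨fun x => ⟨(x.1, x.2), Or.inr x.1.2⟩, by fun_prop⟩ : C(B × Y, attach Z B A)) where
  comm := fun c => rfl
  surj := by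
    rintro ⟨⟨x, y⟩, ⟨hx, hy⟩ | hx⟩
    · exact Or.inl ⟨(⟨x, hx⟩, ⟨y, hy⟩), rfl⟩
    · exact Or.inr ⟨(⟨x, hx⟩, y), rfl⟩
  desc := by
    intro Z' _ a b hab
    let F : Set (attach Z B A) := {x | x.1.2 ∈ A}
    let G : Set (attach Z B A) := {x | x.1.1 ∈ B}
    have hF : IsClosed F := hA.preimage (f := fun x : attach Z B A => x.1.2) (by fun_prop)
    have hG : IsClosed G := hB.preimage (f := fun x : attach Z B A => x.1.1) (by fun_prop)
    have hZ : ∀ x : F, x.1.1.1 ∈ Z := by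
      rintro ⟨⟨x, hx | hx⟩, -⟩
      · exact hx.1
      · exact h hx
    have hFG : F ∪ G = Set.univ := by
      refine Set.eq_univ_of_forall ?_
      rintro ⟨x, hx | hx⟩
      · exact Or.inl hx.2
      · exact Or.inr hx
    obtain ⟨d, d1, d2⟩ := exists_glue_closed hF hG hFG
      ⟨fun x => a (⟨x.1.1.1, hZ x⟩, ⟨x.1.1.2, x.2⟩), by fun_prop⟩
      ⟨fun x => b (⟨x.1.1.1, x.2⟩, x.1.1.2), by fun_prop⟩ (by
        intro x hx hx'
        exact hab (⟨x.1.1, hx'⟩, ⟨x.1.2, hx⟩))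
    exact ⟨d, fun x => d1 ⟨⟨(x.1, x.2), Or.inl ⟨x.1.2, x.2.2⟩⟩, x.2.2⟩,
      fun x => d2 ⟨⟨(x.1, x.2), Or.inr x.1.2⟩, x.1.2⟩⟩

lemma attach_hEquiv [ContractibleSpace Y] (h : B ⊆ Z) (hB : IsClosed B) (hA : IsNDR A) :
    HEquiv (attach Z B A)
      (HoPushout ((inclOf h).prodMap (.id A)) (ContinuousMap.fst : C(B × A, B))) :=
  ((attach_isTopPushout h hB hA.isClosed).hEquiv (hA.hep_prod' B)).symm.trans
    (HoPushout.hEquiv_mapRight _ _ (isHEq_fst (X := B) (Y := Y)))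

variable {P' : Type u} [TopologicalSpace P'] {Z' B' : Set P'}

/-- The equivalences `eZ` and `eB` need not be compatible: both ways round the square from `B` to
the path-connected `Z'` are nullhomotopic, hence homotopic. -/
lemma attach_hEquiv_attach [ContractibleSpace Y] [PathConnectedSpace Z'] (h : B ⊆ Z) (h' : B' ⊆ Z')
    (hB : IsClosed B) (hB' : IsClosed B') (hA : IsNDR A) (n : (inclOf h).Nullhomotopic)
    (n' : (inclOf h').Nullhomotopic) (eZ : HEquiv Z Z') (eB : HEquiv B B') :
    HEquiv (attach Z B A) (attach Z' B' A) := by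
  refine (attach_hEquiv h hB hA).trans (HEquiv.trans ?_ (attach_hEquiv h' hB' hA).symm)
  obtain ⟨φ, hφ⟩ := eZ.exists_isHEq
  obtain ⟨β, hβ⟩ := eB.exists_isHEq
  obtain ⟨z, hz⟩ := n'.comp_left β
  have key : (φ.comp (inclOf h)).Homotopic ((inclOf h').comp β) :=
    ((n.comp_right φ).homotopic_const z).trans hz.symm
  refine (HoPushout.hEquiv_mapLeft _ _ (hφ.prodMap (isHEq_id (X := A)))).trans ?_
  refine (HoPushout.hEquiv_of_homotopic_left (f' := ((inclOf h').prodMap (.id A)).comp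
    (β.prodMap (.id A))) _ (key.prodMap (.refl (.id A)))).trans ?_
  refine (HoPushout.hEquiv_mapRight _ _ hβ).trans ?_
  exact HoPushout.hEquiv_mapMid ((inclOf h').prodMap (.id A)) ContinuousMap.fst
    (hβ.prodMap (isHEq_id (X := A)))

end Attach

/-! ### Polyhedral products of stacked complexes -/

section Polyhedral

variable {V : Type} {Y : Type u}

/-- The polyhedral product of a single pair `(Y, A)`. -/
abbrev polyProd (W : Finset V) (K : PreAbstractSimplicialComplex V) (A : Set Y) :
    Set (∀ _ : W, Y) :=
  polyhedralProduct W K (fun _ => Y) (fun _ => A)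

/-- The part of a polyhedral product that belongs to the face `σ`. -/
def facePart (W σ : Finset V) (A : Set Y) : Set (∀ _ : W, Y) :=
  {x | ∀ w : W, (w : V) ∉ σ → x w ∈ A}

variable {W σ : Finset V} {K : PreAbstractSimplicialComplex V} {A : Set Y}

lemma isClosed_facePart [TopologicalSpace Y] (hA : IsClosed A) : IsClosed (facePart W σ A) := by
  have : facePart W σ A = ⋂ w : W, ⋂ _ : (w : V) ∉ σ, (fun x : (∀ _ : W, Y) => x w) ⁻¹' A := by
    ext x
    simp [facePart]
  rw [this]
  exact isClosed_iInter fun w => isClosed_iInter fun _ => hA.preimage (continuous_apply w)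

lemma facePart_subset (hσ : σ = ∅ ∨ σ ∈ K.faces) (hW : σ ⊆ W) :
    facePart W σ A ⊆ polyProd W K A := fun _ hx => ⟨σ, hσ, hW, hx⟩

/-- The polyhedral product of a simplex. -/
lemma polyProd_simplex_contractible [TopologicalSpace Y] [ContractibleSpace Y] (hne : W.Nonempty) :
    ContractibleSpace (polyProd W (simplex W) A) := by
  have : polyProd W (simplex W) A = Set.univ := by
    refine Set.eq_univ_of_forall fun x => ⟨W, Or.inr ⟨hne, subset_rfl⟩, subset_rfl, ?_⟩
    exact fun w hw => absurd w.2 hw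
  rw [this]
  refine (Homeomorph.Set.univ (W → Y)).contractibleSpace_iff.2 ?_
  obtain ⟨a, ⟨h⟩⟩ := id_nullhomotopic Y
  refine (contractible_iff_id_nullhomotopic _).2 ⟨fun _ => a, ?_⟩
  exact ⟨⟨⟨fun p w => h (p.1, p.2 w), by fun_prop⟩, fun x => by simp, fun x => by ext; simp⟩⟩

/-- The simplex on `σ` and the new vertex `v` can be stacked on the complex `K` with vertex
set `W`. -/
structure IsStackable (W : Finset V) (K : PreAbstractSimplicialComplex V) (σ : Finset V) (v : V) :
    Prop where
  subset : ∀ τ ∈ K.faces, τ ⊆ W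
  vertex : ∀ w ∈ W, {w} ∈ K.faces
  notMem : v ∉ W
  face : σ = ∅ ∨ σ ∈ K.faces

lemma IsStackable.face_subset {v : V} (h : IsStackable W K σ v) : σ ⊆ W := by
  rcases h.face with h' | h'
  · simp [h']
  · exact h.subset σ h'

variable [TopologicalSpace Y]

lemma continuous_facePart_apply (w : W) :
    Continuous fun p : unitInterval × facePart W σ A => p.2.1 w :=
  (continuous_apply w).comp (continuous_subtype_val.comp continuous_snd)

lemma continuous_facePart_homotopy (h : C(unitInterval × Y, Y)) (w : W) :
    Continuous fun p : unitInterval × facePart W σ A => h (p.1, p.2.1 w) :=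
  h.continuous.comp (continuous_fst.prodMk (continuous_facePart_apply w))

variable [DecidableEq V]

/-- Contracting the free coordinates at `σ` leaves a power of `A`, so only the number of vertices
outside `σ` matters. -/
lemma facePart_hEquiv [ContractibleSpace Y] (hne : A.Nonempty) :
    HEquiv (facePart W σ A) (↥(W \ σ) → A) := by
  obtain ⟨a, ha⟩ := hne
  obtain ⟨h⟩ := (id_nullhomotopic Y).homotopic_const a
  let r : C(facePart W σ A, ↥(W \ σ) → A) :=
    ⟨fun x v => ⟨x.1 ⟨v, (Finset.mem_sdiff.1 v.2).1⟩, x.2 _ (Finset.mem_sdiff.1 v.2).2⟩,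
      continuous_pi fun v => Continuous.subtype_mk
        ((continuous_apply _).comp continuous_subtype_val) _⟩
  let s : C(↥(W \ σ) → A, facePart W σ A) :=
    ⟨fun y => ⟨fun w => if hw : (w : V) ∈ σ then a else y ⟨w, Finset.mem_sdiff.2 ⟨w.2, hw⟩⟩, by
      intro w hw
      simp [hw]⟩, by
      refine Continuous.subtype_mk (continuous_pi fun w => ?_) _
      by_cases hw : (w : V) ∈ σ
      · simp only [hw, dite_true]; fun_prop
      · simp only [hw, dite_false]; fun_prop⟩
  refine ⟨⟨r, s, Homotopic.symm ⟨⟨⟨fun p => ⟨fun w => if (w : V) ∈ σ then h (p.1, p.2.1 w)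
    else p.2.1 w, ?_⟩, ?_⟩, ?_, ?_⟩⟩, ?_⟩⟩
  · intro w hw
    simp only [hw, if_false]
    exact p.2.2 w hw
  · refine Continuous.subtype_mk (continuous_pi fun w => ?_) _
    by_cases hw : (w : V) ∈ σ
    · simp only [hw, if_true]; exact continuous_facePart_homotopy h.toContinuousMap w
    · simp only [hw, if_false]; exact continuous_facePart_apply w
  · intro x
    ext w
    simp
  · intro x
    ext w
    by_cases hw : (w : V) ∈ σ <;> simp [r, s, hw]
  · rw [show r.comp s = .id _ from ?_]
    ext y v
    have := (Finset.mem_sdiff.1 v.2).2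
    simp [r, s, this]

/-- The coordinates at `σ` are contracted simultaneously, inside the face part. The others then move
to `a` one by one through `Y`; this stays in the polyhedral product because the moving vertex alone
is a face of `K` and all other coordinates lie in `A`. -/
lemma facePart_homotopic_const [ContractibleSpace Y] {a : Y} (ha : a ∈ A)
    (hσ : σ = ∅ ∨ σ ∈ K.faces) (hW : σ ⊆ W) (hK : ∀ w ∈ W, {w} ∈ K.faces) :
    (inclOf (facePart_subset (A := A) hσ hW)).Homotopic
      (.const _ ⟨fun _ => a, ⟨∅, Or.inl rfl, Finset.empty_subset _, fun _ _ => ha⟩⟩) := by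
  obtain ⟨h⟩ := (id_nullhomotopic Y).homotopic_const a
  have key : ∀ T : Finset V, T ⊆ W → ∃ f : C(facePart W σ A, polyProd W K A),
      (∀ x w, (f x).1 w = if (w : V) ∈ σ ∨ (w : V) ∈ T then a else x.1 w) ∧
      (inclOf (facePart_subset (A := A) hσ hW)).Homotopic f := by
    intro T
    induction T using Finset.induction with
    | empty =>
      intro _
      let H : C(unitInterval × facePart W σ A, polyProd W K A) :=
        ⟨fun p => ⟨fun w => if (w : V) ∈ σ then h (p.1, p.2.1 w) else p.2.1 w, by
          refine ⟨σ, hσ, hW, fun w hw => ?_⟩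
          simp only [hw, if_false]
          exact p.2.2 w hw⟩, by
          refine Continuous.subtype_mk (continuous_pi fun w => ?_) _
          by_cases hw : (w : V) ∈ σ
          · simp only [hw, if_true]; exact continuous_facePart_homotopy h.toContinuousMap w
          · simp only [hw, if_false]; exact continuous_facePart_apply w⟩
      refine ⟨H.comp ⟨fun x => (1, x), by fun_prop⟩, fun x w => ?_, ⟨⟨H, fun x => ?_, fun x => rfl⟩⟩⟩
      · simp [H]
      · ext w
        simp [H]
    | insert v T _ ih =>
      intro hT
      obtain ⟨f, hf, hh⟩ := ih fun w hw => hT (Finset.mem_insert_of_mem hw)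
      have hv : v ∈ W := hT (Finset.mem_insert_self _ _)
      let H : C(unitInterval × facePart W σ A, polyProd W K A) :=
        ⟨fun p => ⟨fun w => if (w : V) ∈ σ ∨ (w : V) ∈ T then a else
            if (w : V) = v then h (p.1, p.2.1 w) else p.2.1 w, by
          refine ⟨{v}, Or.inr (hK v hv), Finset.singleton_subset_iff.2 hv, fun w hw => ?_⟩
          have hw' : (w : V) ≠ v := by simpa using hw
          simp only [hw', if_false]
          split_ifs with hs
          · exact ha
          · exact p.2.2 w fun h => hs (Or.inl h)⟩, by
          refine Continuous.subtype_mk (continuous_pi fun w => ?_) _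
          by_cases hw : (w : V) ∈ σ ∨ (w : V) ∈ T
          · simp only [hw, if_true]; fun_prop
          · by_cases hw' : (w : V) = v
            · simp only [if_neg hw, if_pos hw']
              exact continuous_facePart_homotopy h.toContinuousMap w
            · simp only [hw, hw', if_false]; exact continuous_facePart_apply w⟩
      refine ⟨H.comp ⟨fun x => (1, x), by fun_prop⟩, fun x w => ?_,
        hh.trans ⟨⟨H, fun x => ?_, fun x => rfl⟩⟩⟩
      · by_cases h1 : (w : V) ∈ σ <;> by_cases h2 : (w : V) ∈ T <;> by_cases h3 : (w : V) = v <;>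
          simp [H, h1, h2, h3]
      · ext w
        rw [hf]
        simp [H]
  obtain ⟨f, hf, hh⟩ := key W subset_rfl
  convert hh using 1
  ext x w
  simp [hf]

lemma polyProd_pathConnected [ContractibleSpace Y] (hne : A.Nonempty)
    (hK : ∀ w ∈ W, {w} ∈ K.faces) : PathConnectedSpace (polyProd W K A) := by
  obtain ⟨a, ha⟩ := hne
  let z : polyProd W K A :=
    ⟨fun _ => a, ⟨∅, Or.inl rfl, Finset.empty_subset _, fun _ _ => ha⟩⟩
  have hz : ∀ x, Joined z x := by
    rintro ⟨x, τ, hτ, hW, hx⟩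
    obtain ⟨H⟩ := facePart_homotopic_const ha hτ hW hK
    exact ⟨(H.evalAt (⟨x, hx⟩ : facePart W τ A)).symm⟩
  exact ⟨⟨z⟩, fun x y => (hz x).symm.trans (hz y)⟩

/-- Splitting off the coordinate of a new vertex. -/
def insertHomeo {W : Finset V} {v : V} (hv : v ∉ W) (Y : Type u) [TopologicalSpace Y] :
    (∀ _ : ↥(insert v W), Y) ≃ₜ (∀ _ : W, Y) × Y where
  toFun x := (fun w => x ⟨w, Finset.mem_insert_of_mem w.2⟩, x ⟨v, Finset.mem_insert_self _ _⟩)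
  invFun x w := if hw : (w : V) = v then x.2 else
    x.1 ⟨w, (Finset.mem_insert.1 w.2).resolve_left hw⟩
  left_inv x := by
    ext ⟨w, hw⟩
    by_cases h : w = v
    · subst h; simp
    · simp [h]
  right_inv x := by
    refine Prod.ext (funext fun w => ?_) (by simp)
    have : (w : V) ≠ v := fun h => hv (h ▸ w.2)
    simp [this]
  continuous_toFun := by fun_prop
  continuous_invFun := by
    refine continuous_pi fun w => ?_
    by_cases hw : (w : V) = v
    · simp only [hw, dite_true]; fun_prop
    · simp only [hw, dite_false]; fun_prop

/-- A face of the stacked complex lies in `K`, which forces the coordinate at `v` into `A`, or in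
`insert v σ`, which leaves it free. -/
lemma IsStackable.mem_stack_iff {v : V} (h : IsStackable W K σ v) (x : ∀ _ : ↥(insert v W), Y) :
    x ∈ polyProd (insert v W) (stack K σ v) A ↔
      insertHomeo h.notMem Y x ∈ attach (polyProd W K A) (facePart W σ A) A := by
  constructor
  · rintro ⟨τ, hτ, hW, hx⟩
    have key : τ = ∅ ∨ τ ∈ K.faces → insertHomeo h.notMem Y x ∈
        attach (polyProd W K A) (facePart W σ A) A := by
      intro hτ
      have hs : τ ⊆ W := by
        rcases hτ with h' | h'
        · simp [h']
        · exact h.subset τ h'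
      exact Or.inl ⟨⟨τ, hτ, hs, fun w hw => hx _ hw⟩, hx _ fun hv => h.notMem (hs hv)⟩
    rcases hτ with hτ | hτ | hτ
    · exact key (Or.inl hτ)
    · exact key (Or.inr hτ)
    · refine Or.inr fun w hw => hx _ fun hw' => ?_
      rcases Finset.mem_insert.1 (hτ.2 hw') with h' | h'
      · exact h.notMem (h' ▸ w.2)
      · exact hw h'
  · rintro (⟨⟨τ, hτ, hW, hx⟩, hv⟩ | hx)
    · refine ⟨τ, hτ.imp_right Or.inl, hW.trans (Finset.subset_insert _ _), ?_⟩
      rintro ⟨w, hw⟩ hwτ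
      rcases Finset.mem_insert.1 hw with rfl | hw
      · exact hv
      · exact hx ⟨w, hw⟩ hwτ
    · refine ⟨insert v σ, Or.inr (Or.inr ⟨Finset.insert_nonempty _ _, subset_rfl⟩),
        Finset.insert_subset_insert _ h.face_subset, ?_⟩
      rintro ⟨w, hw⟩ hwτ
      have h1 : w ≠ v := fun e => hwτ (by simp [e])
      have h2 : w ∉ σ := fun e => hwτ (by simp [e])
      exact hx ⟨w, (Finset.mem_insert.1 hw).resolve_left h1⟩ h2

/-- The polyhedral product of a stacked complex. -/
def IsStackable.homeo {v : V} (h : IsStackable W K σ v) (A : Set Y) :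
    polyProd (insert v W) (stack K σ v) A ≃ₜ attach (polyProd W K A) (facePart W σ A) A :=
  (insertHomeo h.notMem Y).subtype h.mem_stack_iff

variable {V' : Type} [DecidableEq V'] {W' σ' : Finset V'} {K' : PreAbstractSimplicialComplex V'}

/-- Both face parts are the same power of `A` up to homotopy, and their inclusions are
nullhomotopic, so `attach_hEquiv_attach` applies. Neither the shape of `K` nor the place of `σ` in
it plays a role. -/
theorem IsStackable.hEquiv [ContractibleSpace Y] (hA : IsNDR A) (hne : A.Nonempty) {v : V} {v' : V'}
    (h : IsStackable W K σ v) (h' : IsStackable W' K' σ' v')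
    (hc : (W \ σ).card = (W' \ σ').card) (e : HEquiv (polyProd W K A) (polyProd W' K' A)) :
    HEquiv (polyProd (insert v W) (stack K σ v) A) (polyProd (insert v' W') (stack K' σ' v') A) := by
  refine (h.homeo A).hEquiv.trans (HEquiv.trans ?_ (h'.homeo A).symm.hEquiv)
  obtain ⟨a, ha⟩ := id hne
  have := polyProd_pathConnected hne h'.vertex
  refine attach_hEquiv_attach (facePart_subset h.face h.face_subset)
    (facePart_subset h'.face h'.face_subset) (isClosed_facePart hA.isClosed)
    (isClosed_facePart hA.isClosed) hA
    ⟨_, facePart_homotopic_const ha h.face h.face_subset h.vertex⟩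
    ⟨_, facePart_homotopic_const ha h'.face h'.face_subset h'.vertex⟩ e ?_
  refine (facePart_hEquiv hne).trans (HEquiv.trans ?_ (facePart_hEquiv hne).symm)
  exact (Homeomorph.piCongrLeft (Y := fun _ => A) (Finset.equivOfCardEq hc)).hEquiv

end Polyhedral
end PolyProd

namespace PolyProd

/-! ### The combinatorics of stacked polytopes -/

section Combinatorics

variable {d : ℕ}

/-- The `k`-th facet of the stacked polytope. -/
def stackedFacet (d k : ℕ) : Finset ℕ := insert 1 (deletedFacet d k)

lemma mem_simplex_iff {V : Type*} {F τ : Finset V} :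
    τ ∈ (simplex F).faces ↔ τ.Nonempty ∧ τ ⊆ F := Iff.rfl

lemma mem_sup_faces {V : Type*} {K L : PreAbstractSimplicialComplex V} {τ : Finset V} :
    τ ∈ (K ⊔ L).faces ↔ τ ∈ K.faces ∨ τ ∈ L.faces := Iff.rfl

lemma mem_inf_faces {V : Type*} {K L : PreAbstractSimplicialComplex V} {τ : Finset V} :
    τ ∈ (K ⊓ L).faces ↔ τ ∈ K.faces ∧ τ ∈ L.faces := Iff.rfl

lemma stackedFacet_one (hd : 1 ≤ d) : stackedFacet d 1 = Finset.Icc 1 (d + 1) := by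
  ext x
  simp only [stackedFacet, deletedFacet, if_true, Finset.mem_insert, Finset.mem_Icc]
  omega

/-- For `k > 0` the vertex 1 lies in `stackFacet d (k + 2)` because `Icc 1 (d - 1)` is nonempty,
which fails for `d = 1`. This is the reason for the bound on `ℓ` in that dimension. -/
lemma stackedFacet_add_two {k : ℕ} (hd : 1 ≤ d) (hk : d = 1 → k = 0) :
    stackedFacet d (k + 2) = insert (d + (k + 2)) (stackFacet d (k + 2)) := by
  ext x
  by_cases h : k = 0
  · subst h
    simp only [stackedFacet, deletedFacet, stackFacet]
    norm_num
    omega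
  · have h1 : k + 2 ≠ 1 := by omega
    have h2 : k + 2 ≠ 2 := by omega
    simp only [stackedFacet, deletedFacet, stackFacet, h1, h2, if_false, Finset.mem_insert,
      Finset.mem_Icc]
    omega

lemma card_deletedFacet {k : ℕ} (hd : 1 ≤ d) (hk1 : 1 ≤ k) (hk : d = 1 → k ≤ 2) :
    (deletedFacet d k).card = d := by
  unfold deletedFacet
  split_ifs with h1 h2
  · rw [Finset.card_insert_of_notMem (by simp)]
    simp; omega
  · rw [Finset.card_insert_of_notMem (by simp)]
    simp; omega
  · rw [Finset.card_insert_of_notMem, Finset.card_insert_of_notMem]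
    · simp; omega
    · simp; omega
    · simp; omega

lemma one_notMem_deletedFacet {k : ℕ} (hd : 1 ≤ d) (hk1 : 1 ≤ k) : 1 ∉ deletedFacet d k := by
  unfold deletedFacet
  split_ifs with h1 h2 <;> simp <;> omega

lemma last_mem_deletedFacet (d k : ℕ) : d + k ∈ deletedFacet d k := by
  unfold deletedFacet
  split_ifs with h1 h2
  · simp [h1]
  · simp [h2]
  · simp

lemma le_of_mem_deletedFacet {k x : ℕ} (h : x ∈ deletedFacet d k) :
    x ≤ d + k := by
  unfold deletedFacet at h
  split_ifs at h with h1 h2 <;> simp at h <;> omega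

lemma two_le_of_mem_deletedFacet {k x : ℕ} (hd : 1 ≤ d) (hk1 : 1 ≤ k) (h : x ∈ deletedFacet d k) :
    2 ≤ x := by
  unfold deletedFacet at h
  split_ifs at h with h1 h2 <;> simp at h <;> omega

/-- The largest vertex `d + k` determines `k`. -/
lemma deletedFacet_injective (d : ℕ) : Function.Injective (deletedFacet d) := by
  intro j k h
  have h1 := le_of_mem_deletedFacet (h ▸ last_mem_deletedFacet d j)
  have h2 := le_of_mem_deletedFacet (h.symm ▸ last_mem_deletedFacet d k)
  omega

lemma deletedFacet_nonempty (d k : ℕ) : (deletedFacet d k).Nonempty := ⟨_, last_mem_deletedFacet d k⟩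

/-- This makes each new simplex meet the earlier ones in a single face of codimension one. -/
lemma erase_deletedFacet_subset {k : ℕ} (hd : 1 ≤ d) (hk1 : 1 ≤ k) :
    (deletedFacet d (k + 1)).erase (d + (k + 1)) ⊆ deletedFacet d k := by
  intro _ hx
  obtain ⟨h1, h2⟩ := Finset.mem_erase.1 hx
  unfold deletedFacet at h2 ⊢
  split_ifs at h2 ⊢ <;> simp at h2 ⊢ <;> omega

lemma mem_stacked_iff {ℓ : ℕ} (hd : 1 ≤ d) (hℓ : 1 ≤ ℓ) (hdℓ : d = 1 → ℓ ≤ 2) {τ : Finset ℕ} :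
    τ ∈ (stacked d ℓ).faces ↔ τ.Nonempty ∧ ∃ k ∈ Set.Icc 1 ℓ, τ ⊆ stackedFacet d k := by
  induction ℓ, hℓ using Nat.le_induction with
  | base =>
    simp only [stacked, mem_simplex_iff, Set.Icc_self, Set.mem_singleton_iff, exists_eq_left,
      stackedFacet_one hd]
  | succ ℓ hℓ ih =>
    obtain ⟨k, rfl⟩ : ∃ k, ℓ = k + 1 := ⟨ℓ - 1, by omega⟩
    simp only [stacked, stack, mem_sup_faces, mem_simplex_iff]
    rw [ih (by omega), ← stackedFacet_add_two hd (by omega)]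
    constructor
    · rintro (⟨h, j, hj, hs⟩ | ⟨h, hs⟩)
      · exact ⟨h, j, ⟨hj.1, by have := hj.2; omega⟩, hs⟩
      · exact ⟨h, k + 2, ⟨by omega, by omega⟩, hs⟩
    · rintro ⟨h, j, hj, hs⟩
      rcases Nat.lt_or_ge j (k + 2) with hlt | hge
      · exact Or.inl ⟨h, j, ⟨hj.1, by omega⟩, hs⟩
      · obtain rfl : j = k + 2 := le_antisymm hj.2 hge
        exact Or.inr ⟨h, hs⟩

lemma subset_deletedFacet {k : ℕ} {τ : Finset ℕ} (h : τ ⊆ stackedFacet d k) (h1 : 1 ∉ τ) :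
    τ ⊆ deletedFacet d k := fun _ hx =>
  (Finset.mem_insert.1 (h hx)).resolve_left fun e => h1 (e ▸ hx)

lemma deletedFacet_mem_stacked {ℓ k : ℕ} (hd : 1 ≤ d) (hdℓ : d = 1 → ℓ ≤ 2)
    (hk : k ∈ Set.Icc 1 ℓ) : deletedFacet d k ∈ (stacked d ℓ).faces :=
  (mem_stacked_iff hd (hk.1.trans hk.2) hdℓ).2
    ⟨deletedFacet_nonempty d k, k, hk, Finset.subset_insert _ _⟩

/-- Every facet contains 1, so a ridge that avoids 1 is a facet with 1 removed, by cardinality. -/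
lemma ridges_without_one {ℓ : ℕ} (hd : 1 ≤ d) (hℓ : 1 ≤ ℓ) (hdℓ : d = 1 → ℓ ≤ 2) :
    {σ | σ ∈ (stacked d ℓ).faces ∧ σ.card = d ∧ 1 ∉ σ} = deletedFacet d '' Set.Icc 1 ℓ := by
  ext σ
  constructor
  · rintro ⟨hσ, hc, h1⟩
    obtain ⟨-, k, hk, hs⟩ := (mem_stacked_iff hd hℓ hdℓ).1 hσ
    refine ⟨k, hk, (Finset.eq_of_subset_of_card_le (subset_deletedFacet hs h1) ?_).symm⟩
    rw [card_deletedFacet hd hk.1 fun h => hk.2.trans (hdℓ h), hc]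
  · rintro ⟨k, hk, rfl⟩
    exact ⟨deletedFacet_mem_stacked hd hdℓ hk, card_deletedFacet hd hk.1 fun h =>
      hk.2.trans (hdℓ h), one_notMem_deletedFacet hd hk.1⟩

/-- A facet through this ridge is some `stackedFacet d j`. Without the vertex 1 it contains the
ridge and has equal size, so `j = k` by injectivity. -/
lemma existsUnique_facet {ℓ k : ℕ} (hd : 1 ≤ d) (hdℓ : d = 1 → ℓ ≤ 2) (hk : k ∈ Set.Icc 1 ℓ) :
    ∃! ρ : Finset ℕ, ρ ∈ (stacked d ℓ).faces ∧ ρ.card = d + 1 ∧ deletedFacet d k ⊆ ρ := by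
  have hc : ∀ j ∈ Set.Icc 1 ℓ, (stackedFacet d j).card = d + 1 := fun j hj => by
    rw [stackedFacet, Finset.card_insert_of_notMem (one_notMem_deletedFacet hd hj.1),
      card_deletedFacet hd hj.1 fun h => hj.2.trans (hdℓ h)]
  refine ⟨stackedFacet d k, ⟨(mem_stacked_iff hd (hk.1.trans hk.2) hdℓ).2
    ⟨Finset.insert_nonempty _ _, k, hk, subset_rfl⟩, hc k hk, Finset.subset_insert _ _⟩, ?_⟩
  rintro ρ ⟨hρ, hρc, hs⟩
  obtain ⟨-, j, hj, hs'⟩ := (mem_stacked_iff hd (hk.1.trans hk.2) hdℓ).1 hρ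
  have hρj : ρ = stackedFacet d j :=
    Finset.eq_of_subset_of_card_le hs' (by rw [hc j hj, hρc])
  have hjk : deletedFacet d k ⊆ deletedFacet d j :=
    subset_deletedFacet (hρj ▸ hs) (one_notMem_deletedFacet hd hk.1)
  have := deletedFacet_injective d (Finset.eq_of_subset_of_card_le hjk (by
    rw [card_deletedFacet hd hj.1 fun h => hj.2.trans (hdℓ h),
      card_deletedFacet hd hk.1 fun h => hk.2.trans (hdℓ h)]))
  rw [hρj, this]

lemma boundary_ridges_without_one {ℓ : ℕ} (hd : 1 ≤ d) (hℓ : 1 ≤ ℓ) (hdℓ : d = 1 → ℓ ≤ 2) :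
    {σ | σ ∈ (boundary d (stacked d ℓ)).faces ∧ σ.card = d ∧ 1 ∉ σ} =
      deletedFacet d '' Set.Icc 1 ℓ := by
  ext σ
  constructor
  · rintro ⟨⟨hn, ρ, hρ, hc, hs, -⟩, hc', h1⟩
    obtain rfl : σ = ρ := Finset.eq_of_subset_of_card_le hs (by rw [hc, hc'])
    rw [← ridges_without_one hd hℓ hdℓ]
    exact ⟨hρ, hc, h1⟩
  · rintro ⟨k, hk, rfl⟩
    have hc := card_deletedFacet hd hk.1 fun h => hk.2.trans (hdℓ h)
    exact ⟨⟨deletedFacet_nonempty d k, _, deletedFacet_mem_stacked hd hdℓ hk, hc, subset_rfl,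
      existsUnique_facet hd hdℓ hk⟩, hc, one_notMem_deletedFacet hd hk.1⟩

lemma ncard_deletedFacets (d ℓ : ℕ) : (deletedFacet d '' Set.Icc 1 ℓ).ncard = ℓ := by
  rw [Set.ncard_image_of_injective _ (deletedFacet_injective d)]
  simp [← Finset.coe_Icc, Set.ncard_coe_finset]

lemma mem_deleted_iff {ℓ : ℕ} (hd : 1 ≤ d) (hℓ : 1 ≤ ℓ) (hdℓ : d = 1 → ℓ ≤ 2) {τ : Finset ℕ} :
    τ ∈ (deleted d ℓ).faces ↔ τ.Nonempty ∧ ∃ k ∈ Set.Icc 1 ℓ, τ ⊆ deletedFacet d k := by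
  constructor
  · rintro ⟨⟨hn, σ, hσ, -, hs, -⟩, hW⟩
    obtain ⟨-, k, hk, hs'⟩ := (mem_stacked_iff hd hℓ hdℓ).1 hσ
    refine ⟨hn, k, hk, subset_deletedFacet (hs.trans hs') fun h1 => ?_⟩
    have := hW h1
    simp [deletedVertices] at this
  · rintro ⟨hn, k, hk, hs⟩
    refine ⟨⟨hn, _, deletedFacet_mem_stacked hd hdℓ hk,
      card_deletedFacet hd hk.1 fun h => hk.2.trans (hdℓ h), hs, existsUnique_facet hd hdℓ hk⟩, ?_⟩
    intro x hx
    have h1 := two_le_of_mem_deletedFacet hd hk.1 (hs hx)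
    have h2 := le_of_mem_deletedFacet (hs hx)
    have h3 := hk.2
    simp only [deletedVertices, Finset.mem_erase, Finset.mem_Icc]
    omega

/-- The face along which the `(k + 1)`-st simplex of `∂L - {1}` is glued. -/
def gluingFace (d k : ℕ) : Finset ℕ := (deletedFacet d (k + 1)).erase (d + (k + 1))

lemma insert_gluingFace (d k : ℕ) :
    insert (d + (k + 1)) (gluingFace d k) = deletedFacet d (k + 1) :=
  Finset.insert_erase (last_mem_deletedFacet d (k + 1))

lemma card_gluingFace {k : ℕ} (hd : 1 ≤ d) (hk : d = 1 → k ≤ 1) :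
    (gluingFace d k).card + 1 = d := by
  rw [gluingFace, Finset.card_erase_add_one (last_mem_deletedFacet d (k + 1)),
    card_deletedFacet hd (by omega) (by omega)]

lemma deleted_one (hd : 1 ≤ d) : deleted d 1 = simplex (deletedFacet d 1) := by
  ext τ
  rw [mem_deleted_iff hd le_rfl (by omega), mem_simplex_iff]
  simp

lemma deleted_succ {k : ℕ} (hd : 1 ≤ d) (hk1 : 1 ≤ k) (hk : d = 1 → k ≤ 1) :
    deleted d (k + 1) = deleted d k ⊔ simplex (deletedFacet d (k + 1)) := by
  ext τ
  rw [mem_sup_faces, mem_deleted_iff hd (by omega) (by omega), mem_deleted_iff hd hk1 (by omega),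
    mem_simplex_iff]
  constructor
  · rintro ⟨hn, j, hj, hs⟩
    rcases Nat.lt_or_ge j (k + 1) with hlt | hge
    · exact Or.inl ⟨hn, j, ⟨hj.1, by omega⟩, hs⟩
    · obtain rfl : j = k + 1 := le_antisymm hj.2 hge
      exact Or.inr ⟨hn, hs⟩
  · rintro (⟨hn, j, hj, hs⟩ | ⟨hn, hs⟩)
    · exact ⟨hn, j, ⟨hj.1, by have := hj.2; omega⟩, hs⟩
    · exact ⟨hn, k + 1, ⟨by omega, le_rfl⟩, hs⟩

lemma deleted_inf {k : ℕ} (hd : 1 ≤ d) (hk1 : 1 ≤ k) (hk : d = 1 → k ≤ 1) :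
    deleted d k ⊓ simplex (deletedFacet d (k + 1)) = simplex (gluingFace d k) := by
  ext τ
  rw [mem_inf_faces, mem_deleted_iff hd hk1 (by omega), mem_simplex_iff, mem_simplex_iff]
  constructor
  · rintro ⟨⟨hn, j, hj, hs⟩, -, hs'⟩
    refine ⟨hn, fun x hx => Finset.mem_erase.2 ⟨?_, hs' hx⟩⟩
    have := le_of_mem_deletedFacet (hs hx)
    have := hj.2
    omega
  · rintro ⟨hn, hs⟩
    exact ⟨⟨hn, k, ⟨hk1, le_rfl⟩, hs.trans (erase_deletedFacet_subset hd hk1)⟩, hn,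
      hs.trans (Finset.erase_subset _ _)⟩

lemma isSuccessiveGluing_deleted {ℓ : ℕ} (hd : 1 ≤ d) (hdℓ : d = 1 → ℓ ≤ 2) :
    IsSuccessiveGluing d ℓ (deleted d ℓ) := by
  refine ⟨deleted d, ⟨_, card_deletedFacet hd le_rfl (by omega), deleted_one hd⟩, ?_, rfl⟩
  intro k hk2 hkℓ
  obtain ⟨k, rfl⟩ : ∃ j, k = j + 1 := ⟨k - 1, by omega⟩
  exact ⟨_, gluingFace d k, card_deletedFacet hd (by omega) (by omega),
    card_gluingFace hd (by omega), Finset.erase_subset _ _, deleted_inf hd (by omega) (by omega),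
    deleted_succ hd (by omega) (by omega)⟩

lemma ncard_ridges {ℓ : ℕ} (hd : 1 ≤ d) (hℓ : 1 ≤ ℓ) (hdℓ : d = 1 → ℓ ≤ 2) :
    {σ | σ ∈ (stacked d ℓ).faces ∧ σ.card = d}.ncard = ℓ * d + 1 := by
  induction ℓ, hℓ using Nat.le_induction with
  | base =>
    have : {σ | σ ∈ (stacked d 1).faces ∧ σ.card = d} =
        ↑(Finset.powersetCard d (Finset.Icc 1 (d + 1))) := by
      ext σ
      simp only [stacked, mem_simplex_iff, Set.mem_ofPred_eq, Finset.mem_coe,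
        Finset.mem_powersetCard]
      constructor
      · exact fun h => ⟨h.1.2, h.2⟩
      · exact fun h => ⟨⟨Finset.card_pos.1 (by omega), h.1⟩, h.2⟩
    rw [this, Set.ncard_coe_finset, Finset.card_powersetCard]
    simp
  | succ ℓ hℓ ih =>
    obtain ⟨k, rfl⟩ : ∃ k, ℓ = k + 1 := ⟨ℓ - 1, by omega⟩
    specialize ih (by omega)
    have hf := stackedFacet_add_two hd (k := k) (by omega)
    set v := d + (k + 2)
    set S := stackFacet d (k + 2)
    have hvk : ∀ j ∈ Set.Icc 1 (k + 1), v ∉ stackedFacet d j := fun j hj h => by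
      rcases Finset.mem_insert.1 h with h | h
      · omega
      · have := le_of_mem_deletedFacet h
        have := hj.2
        omega
    have hvS : v ∉ S := by
      simp only [S, v, stackFacet]
      split_ifs <;> simp <;> omega
    have hSc : S.card = d := by
      have h1 : (stackedFacet d (k + 2)).card = d + 1 := by
        rw [stackedFacet, Finset.card_insert_of_notMem (one_notMem_deletedFacet hd (by omega)),
          card_deletedFacet hd (by omega) (by omega)]
      rw [hf, Finset.card_insert_of_notMem hvS] at h1
      omega
    have hSsub : S ⊆ stackedFacet d (k + 1) := by
      intro x hx
      have hx' : x ∈ stackedFacet d (k + 2) := hf ▸ Finset.mem_insert_of_mem hx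
      rcases Finset.mem_insert.1 hx' with h | h
      · rw [h]; exact Finset.mem_insert_self _ _
      · exact Finset.mem_insert_of_mem (erase_deletedFacet_subset hd (by omega)
          (Finset.mem_erase.2 ⟨ne_of_mem_of_not_mem hx hvS, h⟩))
    -- The new ridges are those through `v`, and there are `d.choose (d - 1) = d` of them. A face of
    -- the new simplex that avoids `v` lies in `S`, hence in the previous facet.
    have hunion : {σ | σ ∈ (stacked d (k + 2)).faces ∧ σ.card = d} =
        {σ | σ ∈ (stacked d (k + 1)).faces ∧ σ.card = d} ∪
          ↑((Finset.powersetCard (d - 1) S).image (insert v)) := by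
      ext σ
      simp only [Set.mem_ofPred_eq, Set.mem_union, Finset.coe_image, Set.mem_image, Finset.mem_coe,
        Finset.mem_powersetCard, stacked, stack, mem_sup_faces, mem_simplex_iff]
      constructor
      · rintro ⟨h | ⟨hn, hs⟩, hc⟩
        · exact Or.inl ⟨h, hc⟩
        · by_cases hv : v ∈ σ
          · refine Or.inr ⟨σ.erase v, ⟨?_, ?_⟩, Finset.insert_erase hv⟩
            · intro x hx
              obtain ⟨h1, h2⟩ := Finset.mem_erase.1 hx
              exact (Finset.mem_insert.1 (hs h2)).resolve_left h1
            · rw [Finset.card_erase_of_mem hv, hc]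
          · refine Or.inl ⟨(mem_stacked_iff hd (by omega) (by omega)).2 ⟨hn, k + 1,
              ⟨by omega, le_rfl⟩, fun x hx => hSsub ?_⟩, hc⟩
            exact (Finset.mem_insert.1 (hs hx)).resolve_left (ne_of_mem_of_not_mem hx hv)
      · rintro (⟨h, hc⟩ | ⟨τ, ⟨hτ, hc⟩, rfl⟩)
        · exact ⟨Or.inl h, hc⟩
        · refine ⟨Or.inr ⟨Finset.insert_nonempty _ _, Finset.insert_subset_insert _ hτ⟩, ?_⟩
          rw [Finset.card_insert_of_notMem fun h => hvS (hτ h), hc]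
          omega
    have hdisj : Disjoint {σ | σ ∈ (stacked d (k + 1)).faces ∧ σ.card = d}
        (↑((Finset.powersetCard (d - 1) S).image (insert v)) : Set (Finset ℕ)) := by
      rw [Set.disjoint_left]
      rintro σ ⟨hσ, -⟩ hσ'
      obtain ⟨τ, -, rfl⟩ := Finset.mem_image.1 (Finset.mem_coe.1 hσ')
      obtain ⟨-, j, hj, hs⟩ := (mem_stacked_iff hd (by omega) (by omega)).1 hσ
      exact hvk j hj (hs (Finset.mem_insert_self _ _))
    -- An infinite set would have `ncard` zero.
    have hfin : {σ | σ ∈ (stacked d (k + 1)).faces ∧ σ.card = d}.Finite :=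
      Set.finite_of_ncard_pos (by rw [ih]; omega)
    rw [hunion, Set.ncard_union_eq hdisj hfin (Finset.finite_toSet _), ih, Set.ncard_coe_finset,
      Finset.card_image_of_injOn, Finset.card_powersetCard, hSc]
    · have : d.choose (d - 1) = d := by
        obtain ⟨e, rfl⟩ : ∃ e, d = e + 1 := ⟨d - 1, by omega⟩
        simp
      rw [this]
      ring
    · intro τ hτ τ' hτ' h
      have h1 : v ∉ τ := fun h => hvS ((Finset.mem_powersetCard.1 hτ).1 h)
      have h2 : v ∉ τ' := fun h => hvS ((Finset.mem_powersetCard.1 hτ').1 h)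
      have h : insert v τ = insert v τ' := h
      rw [← Finset.erase_insert h1, h, Finset.erase_insert h2]

lemma deletedVertices_succ {k : ℕ} (hd : 1 ≤ d) (hk1 : 1 ≤ k) :
    deletedVertices d (k + 1) = insert (d + (k + 1)) (deletedVertices d k) := by
  ext x
  simp only [deletedVertices, Finset.mem_erase, Finset.mem_Icc, Finset.mem_insert]
  omega

lemma deleted_succ_eq_stack {k : ℕ} (hd : 1 ≤ d) (hk1 : 1 ≤ k) (hk : d = 1 → k ≤ 1) :
    deleted d (k + 1) = stack (deleted d k) (gluingFace d k) (d + (k + 1)) := by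
  rw [deleted_succ hd hk1 hk, stack, insert_gluingFace]

lemma isStackable_deleted {k : ℕ} (hd : 1 ≤ d) (hk1 : 1 ≤ k) (hk : d = 1 → k ≤ 1) :
    IsStackable (deletedVertices d k) (deleted d k) (gluingFace d k) (d + (k + 1)) where
  subset := fun _ h => h.2
  vertex := by
    intro w hw
    simp only [deletedVertices, Finset.mem_erase, Finset.mem_Icc] at hw
    refine (mem_deleted_iff hd hk1 (by omega)).2 ⟨Finset.singleton_nonempty w, ?_⟩
    simp only [Finset.singleton_subset_iff]
    by_cases h : w ≤ d
    · refine ⟨1, ⟨le_rfl, hk1⟩, ?_⟩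
      simp [deletedFacet]
      omega
    · refine ⟨w - d, ⟨by omega, by omega⟩, ?_⟩
      have := last_mem_deletedFacet d (w - d)
      rwa [show d + (w - d) = w by omega] at this
  notMem := by
    simp [deletedVertices]
  face := by
    rcases Finset.eq_empty_or_nonempty (gluingFace d k) with h | h
    · exact Or.inl h
    · exact Or.inr ((mem_deleted_iff hd hk1 (by omega)).2
        ⟨h, k, ⟨hk1, le_rfl⟩, erase_deletedFacet_subset hd hk1⟩)

/-- Of the `d + k - 1` vertices, `d - 1` lie in the gluing face. The difference is independent of
`d` and equals the number for `k` points and the empty face. -/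
lemma card_deletedVertices_sdiff {k : ℕ} (hd : 1 ≤ d) (hk1 : 1 ≤ k) (hk : d = 1 → k ≤ 1) :
    (deletedVertices d k \ gluingFace d k).card = k := by
  have h1 := Finset.card_sdiff_add_card_eq_card (isStackable_deleted hd hk1 hk).face_subset
  have h2 := card_gluingFace hd hk
  have h3 : (deletedVertices d k).card = d + k - 1 := by
    rw [deletedVertices, Finset.card_erase_of_mem (by simp; omega)]
    simp
  omega

/-- An isolated point is a stack on the empty face, so points obey the same recursion as `∂L - {1}`.
-/
lemma points_succ (k : ℕ) :
    points (Finset.Icc 1 (k + 1)) = stack (points (Finset.Icc 1 k)) ∅ (k + 1) := by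
  ext τ
  simp only [points, stack, mem_sup_faces, mem_simplex_iff, Set.mem_ofPred_eq]
  constructor
  · rintro ⟨v, hv, rfl⟩
    by_cases h : v = k + 1
    · exact Or.inr ⟨Finset.singleton_nonempty v, by simp [h]⟩
    · refine Or.inl ⟨v, ?_, rfl⟩
      simp only [Finset.mem_Icc] at hv ⊢
      omega
  · rintro (⟨v, hv, rfl⟩ | ⟨hn, hs⟩)
    · refine ⟨v, ?_, rfl⟩
      simp only [Finset.mem_Icc] at hv ⊢
      omega
    · exact ⟨k + 1, by simp, (Finset.subset_singleton_iff.1 hs).resolve_left hn.ne_empty⟩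

lemma isStackable_points (k : ℕ) :
    IsStackable (Finset.Icc 1 k) (points (Finset.Icc 1 k)) ∅ (k + 1) where
  subset := by
    rintro _ ⟨v, hv, rfl⟩
    simpa using hv
  vertex := fun w hw => ⟨w, hw, rfl⟩
  notMem := by simp
  face := Or.inl rfl

lemma Icc_succ_eq_insert (k : ℕ) : Finset.Icc 1 (k + 1) = insert (k + 1) (Finset.Icc 1 k) := by
  ext x
  simp only [Finset.mem_Icc, Finset.mem_insert]
  omega

lemma points_one : points (Finset.Icc 1 1) = simplex (Finset.Icc 1 1) := by
  ext τ
  simp only [points, mem_simplex_iff, Set.mem_ofPred_eq, Finset.Icc_self, Finset.mem_singleton,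
    exists_eq_left]
  constructor
  · rintro rfl; simp
  · exact fun h => (Finset.subset_singleton_iff.1 h.2).resolve_left h.1.ne_empty

end Combinatorics

/-- The polyhedral products of `∂L - {1}` and of `ℓ` disjoint points are homotopy equivalent. -/
theorem deleted_hEquiv_points {Y : Type u} [TopologicalSpace Y] [ContractibleSpace Y] {A : Set Y}
    (hA : IsNDR A) (hne : A.Nonempty) {d ℓ : ℕ} (hd : 1 ≤ d) (hℓ : 1 ≤ ℓ) (hdℓ : d = 1 → ℓ ≤ 2) :
    HEquiv (polyProd (deletedVertices d ℓ) (deleted d ℓ) A)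
      (polyProd (Finset.Icc 1 ℓ) (points (Finset.Icc 1 ℓ)) A) := by
  induction ℓ, hℓ using Nat.le_induction with
  | base =>
    have h1 : deletedVertices d 1 = deletedFacet d 1 := by
      ext x
      simp only [deletedVertices, deletedFacet, if_true, Finset.mem_erase, Finset.mem_Icc,
        Finset.mem_insert]
      omega
    rw [deleted_one hd, points_one, h1]
    have i1 := polyProd_simplex_contractible (A := A) (deletedFacet_nonempty d 1)
    have i2 := polyProd_simplex_contractible (A := A) (W := Finset.Icc 1 1) (by simp)
    exact ContractibleSpace.hequiv _ _
  | succ k hk ih =>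
    specialize ih (by omega)
    -- Both stacks leave exactly `k` vertices outside the gluing face.
    have key := (isStackable_deleted hd hk (by omega)).hEquiv hA hne (isStackable_points k)
      (by rw [card_deletedVertices_sdiff hd hk (by omega)]; simp) ih
    rw [← deleted_succ_eq_stack hd hk (by omega), ← deletedVertices_succ hd hk, ← points_succ,
      ← Icc_succ_eq_insert] at key
    exact key

end PolyProd

namespace PolyProd

open Topology unitInterval

/-! ### The cone and its base -/

section ConePair

variable {X : Type u}

/-- The projection from the cylinder onto the cone. -/
def Cone.mk (p : X × I) : Cone X := Quotient.mk (collapse {p : X × I | p.2 = 1}) p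

lemma Cone.mk_one (x y : X) : Cone.mk (x, 1) = Cone.mk (y, 1) := Quotient.sound (Or.inr ⟨rfl, rfl⟩)

lemma Cone.mem_base_iff {x : X} {s : I} : Cone.mk (x, s) ∈ Cone.base X ↔ s = 0 := by
  constructor
  · rintro ⟨y, hy⟩
    rcases Quotient.exact hy with e | ⟨e, -⟩
    · exact (congrArg Prod.snd e).symm
    · exact absurd e (by simp)
  · rintro rfl
    exact ⟨x, rfl⟩

lemma Cone.base_nonempty [Nonempty X] : (Cone.base X).Nonempty := Set.range_nonempty _

variable [TopologicalSpace X]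

lemma Cone.isQuotientMap_mk : IsQuotientMap (Cone.mk (X := X)) := isQuotientMap_quotient_mk'

lemma Cone.continuous_mk : Continuous (Cone.mk (X := X)) := Cone.isQuotientMap_mk.continuous

/-- A homotopy out of a cone, from a homotopy out of the cylinder that is constant on the top. -/
def Cone.liftHomotopy {Z : Type*} [TopologicalSpace Z] (f : C(I × X × I, Z))
    (h : ∀ t x y, f (t, x, 1) = f (t, y, 1)) : C(I × Cone X, Z) where
  toFun p := Quotient.lift (fun q => f (p.1, q)) (by
    rintro ⟨x, s⟩ ⟨y, r⟩ (e | ⟨hs, hr⟩)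
    · rw [e]
    · obtain rfl : s = 1 := hs
      obtain rfl : r = 1 := hr
      exact h _ _ _) p.2
  -- The product of the quotient map with the locally compact `I` is again a quotient map.
  continuous_toFun := Cone.isQuotientMap_mk.continuous_lift_prod_right f.continuous

@[simp] lemma Cone.liftHomotopy_mk {Z : Type*} [TopologicalSpace Z] (f : C(I × X × I, Z))
    (h : ∀ t x y, f (t, x, 1) = f (t, y, 1)) (t : I) (p : X × I) :
    Cone.liftHomotopy f h (t, Cone.mk p) = f (t, p) := rfl

instance [Nonempty X] : ContractibleSpace (Cone X) := by
  obtain ⟨x₀⟩ := ‹Nonempty X›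
  refine (contractible_iff_id_nullhomotopic _).2 ⟨Cone.mk (x₀, 1), ⟨⟨Cone.liftHomotopy
    ⟨fun p => Cone.mk (p.2.1, max p.1 p.2.2), Cone.continuous_mk.comp (by fun_prop)⟩ ?_, ?_, ?_⟩⟩⟩
  · intro t x y
    simpa [max_eq_right (unitInterval.le_one' (t := t))] using Cone.mk_one x y
  · intro c
    obtain ⟨⟨x, s⟩, rfl⟩ := Cone.isQuotientMap_mk.surjective c
    simp
  · intro c
    obtain ⟨⟨x, s⟩, rfl⟩ := Cone.isQuotientMap_mk.surjective c
    simpa [max_eq_left (unitInterval.le_one' (t := s))] using Cone.mk_one x x₀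

/-- At time `t` the collar `s ≤ t/2` is pushed onto the base and the rest is stretched over the
cone, while `τ` is `t - 2s` cut off at 0. Where `τ` is positive, the point has reached the base. -/
lemma Cone.isNDR_base : IsNDR (Cone.base X) where
  isClosed := by
    rw [← Cone.isQuotientMap_mk.isClosed_preimage]
    have : Cone.mk ⁻¹' Cone.base X = {p : X × I | p.2 = 0} := by
      ext ⟨x, s⟩
      exact Cone.mem_base_iff
    rw [this]
    exact isClosed_eq continuous_snd continuous_const
  exists_retraction := by
    have hpos : ∀ t : I, 0 < 1 - (t : ℝ) / 2 := fun t => by linarith [t.2.2]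
    let ψ : C(I × I, I) := ⟨fun p => Set.projIcc 0 1 zero_le_one
      (((p.2 : ℝ) - (p.1 : ℝ) / 2) / (1 - (p.1 : ℝ) / 2)), by
        refine continuous_projIcc.comp (Continuous.div (by fun_prop) (by fun_prop) fun p => ?_)
        exact (hpos p.1).ne'⟩
    have hψ : ∀ t, ψ (t, 1) = 1 := fun t => by
      simp only [ψ, ContinuousMap.coe_mk, Set.Icc.coe_one, div_self (hpos t).ne',
        Set.projIcc_right]
      rfl
    refine ⟨Cone.liftHomotopy ⟨fun p => Cone.mk (p.2.1, ψ (p.1, p.2.2)),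
        Cone.continuous_mk.comp (by fun_prop)⟩ ?_,
      Cone.liftHomotopy ⟨fun p => Set.projIcc 0 1 zero_le_one ((p.1 : ℝ) - 2 * p.2.2),
        by fun_prop⟩ ?_, ?_, ?_, ?_, ?_⟩
    · intro t x y
      simpa [hψ] using Cone.mk_one x y
    · intro t x y
      simp
    · intro c
      obtain ⟨⟨x, s⟩, rfl⟩ := Cone.isQuotientMap_mk.surjective c
      simp [ψ]
    · intro c
      obtain ⟨⟨x, s⟩, rfl⟩ := Cone.isQuotientMap_mk.surjective c
      have : -(2 * (s : ℝ)) ≤ 0 := by linarith [s.2.1]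
      simp [Set.projIcc_of_le_left _ this]
    · rintro t _ ⟨x, rfl⟩
      change Cone.liftHomotopy _ _ (t, Cone.mk (x, 0)) = Cone.mk (x, 0) ∧
        Cone.liftHomotopy _ _ (t, Cone.mk (x, 0)) = t
      have h0 : ψ (t, 0) = 0 := by
        refine Set.projIcc_of_le_left zero_le_one (div_nonpos_of_nonpos_of_nonneg ?_ (hpos t).le)
        simpa using div_nonneg t.2.1 zero_le_two
      simp [h0]
    · rintro ⟨t, c⟩
      obtain ⟨⟨x, s⟩, rfl⟩ := Cone.isQuotientMap_mk.surjective c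
      rcases le_total (t : ℝ) (2 * s) with h | h
      · left
        have : (t : ℝ) - 2 * s ≤ 0 := by linarith
        simp [Set.projIcc_of_le_left _ this]
      · right
        rw [Cone.liftHomotopy_mk]
        refine Cone.mem_base_iff.2 (Set.projIcc_of_le_left zero_le_one ?_)
        exact div_nonpos_of_nonpos_of_nonneg (by simp; linarith) (hpos t).le

end ConePair

/-! ### The disc and its boundary -/

section DiscPair

variable (E : Type u) [NormedAddCommGroup E]

/-- The closed unit ball of a normed space. -/
abbrev Disc : Type u := Metric.closedBall (0 : E) 1

/-- The boundary of the closed unit ball. -/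
abbrev discBoundary : Set (Disc E) := {z | ‖(z : E)‖ = 1}

variable {E}

lemma Disc.norm_le (z : Disc E) : ‖(z : E)‖ ≤ 1 := mem_closedBall_zero_iff.1 z.2

variable [NormedSpace ℝ E]

instance : ContractibleSpace (Disc E) :=
  (convex_closedBall (0 : E) 1).contractibleSpace ⟨0, by simp⟩

-- The collar has `1 - ‖z‖` as its coordinate: a point with `‖z‖ ≥ 1 - t/2` is projected radially
-- onto the boundary, and the smaller ball is scaled up.
variable (E) in
lemma isNDR_discBoundary : IsNDR (discBoundary E) where
  isClosed := isClosed_eq (by fun_prop) continuous_const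
  exists_retraction := by
    have hpos : ∀ (t : I) (z : E), 0 < max ‖z‖ (1 - (t : ℝ) / 2) := fun t z =>
      lt_max_of_lt_right (by linarith [t.2.2])
    have hn : ∀ (t : I) (z : E), ‖(max ‖z‖ (1 - (t : ℝ) / 2))⁻¹ • z‖ =
        ‖z‖ / max ‖z‖ (1 - (t : ℝ) / 2) := fun t z => by
      rw [norm_smul, norm_inv, Real.norm_of_nonneg (hpos t z).le]
      exact (div_eq_inv_mul _ _).symm
    refine ⟨⟨fun p => ⟨(max ‖(p.2 : E)‖ (1 - (p.1 : ℝ) / 2))⁻¹ • (p.2 : E), ?_⟩, ?_⟩,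
      ⟨fun p => Set.projIcc 0 1 zero_le_one ((p.1 : ℝ) - 2 * (1 - ‖(p.2 : E)‖)), by fun_prop⟩,
      ?_, ?_, ?_, ?_⟩
    · rw [mem_closedBall_zero_iff, hn]
      exact div_le_one_of_le₀ (le_max_left _ _) (hpos _ _).le
    · refine Continuous.subtype_mk (Continuous.smul (Continuous.inv₀ (by fun_prop) fun p => ?_)
        (by fun_prop)) _
      exact (hpos _ _).ne'
    · intro z
      ext
      simp [max_eq_right z.norm_le]
    · intro z
      have : (0 : ℝ) - 2 * (1 - ‖(z : E)‖) ≤ 0 := by linarith [z.norm_le]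
      simpa using Set.projIcc_of_le_left zero_le_one this
    · intro t z hz
      have hz : ‖(z : E)‖ = 1 := hz
      have : 1 - (t : ℝ) / 2 ≤ 1 := by linarith [t.2.1]
      constructor
      · ext
        simp [hz, max_eq_left this]
      · simp [hz]
    · rintro ⟨t, z⟩
      rcases le_total ‖(z : E)‖ (1 - (t : ℝ) / 2) with h | h
      · left
        exact Set.projIcc_of_le_left zero_le_one (by simp only; linarith)
      · right
        change ‖(max ‖(z : E)‖ (1 - (t : ℝ) / 2))⁻¹ • (z : E)‖ = 1
        rw [hn, max_eq_left h, div_self]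
        exact (lt_of_lt_of_le (by linarith [t.2.2]) h).ne'

end DiscPair

end PolyProd

namespace PolyProd

open Topology

/-! ### Spheres as quotients of discs and as joins with the circle -/

section Spheres

/-- Euclidean space. -/
abbrev Euc (k : ℕ) : Type := EuclideanSpace ℝ (Fin k)

/-- Adding a first coordinate to a vector. -/
noncomputable def consE {k : ℕ} (a : ℝ) (v : Euc k) : Euc (k + 1) := WithLp.toLp 2 (Fin.cons a v.ofLp)

variable {k : ℕ}

lemma continuous_consE : Continuous fun p : ℝ × Euc k => consE p.1 p.2 := by
  refine (PiLp.continuous_toLp 2 _).comp (continuous_pi fun i => ?_)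
  refine Fin.cases ?_ (fun i => ?_) i
  · simpa using continuous_fst
  · simp only [Fin.cons_succ]
    fun_prop

lemma norm_consE_sq (a : ℝ) (v : Euc k) : ‖consE a v‖ ^ 2 = a ^ 2 + ‖v‖ ^ 2 := by
  simp [EuclideanSpace.norm_sq_eq, Fin.sum_univ_succ, consE]

lemma consE_inj {a b : ℝ} {v w : Euc k} (h : consE a v = consE b w) : a = b ∧ v = w := by
  have h : (Fin.cons a v.ofLp : Fin (k + 1) → ℝ) = Fin.cons b w.ofLp := congrArg WithLp.ofLp h
  refine ⟨by simpa using congrFun h 0, ?_⟩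
  ext i
  simpa using congrFun h i.succ

lemma exists_consE (x : Euc (k + 1)) : ∃ a v, consE a v = x :=
  ⟨x 0, WithLp.toLp 2 (Fin.tail x.ofLp), by
    ext i
    refine Fin.cases ?_ (fun i => ?_) i <;> simp [consE]⟩

lemma consE_one_zero : consE 1 (0 : Euc k) = EuclideanSpace.single 0 1 := by
  ext i
  refine Fin.cases ?_ (fun i => ?_) i <;> simp [consE]

/-- The map from the disc onto the sphere that collapses the boundary. -/
noncomputable def discToSphere (k : ℕ) : C(Disc (Euc k), Sphere k) where
  -- For `‖z‖ = cos θ` the first coordinate is `cos 2θ` and the rest has norm `sin 2θ`: the boundary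
  -- goes to the base point, the centre to its antipode.
  toFun z := ⟨consE (2 * ‖(z : Euc k)‖ ^ 2 - 1) ((2 * √(1 - ‖(z : Euc k)‖ ^ 2)) • (z : Euc k)), by
    have h := z.norm_le
    have h1 : 0 ≤ 1 - ‖(z : Euc k)‖ ^ 2 := by nlinarith [norm_nonneg (z : Euc k)]
    rw [mem_sphere_zero_iff_norm, ← sq_eq_sq₀ (norm_nonneg _) zero_le_one, norm_consE_sq,
      norm_smul, mul_pow, Real.norm_eq_abs, sq_abs, mul_pow, Real.sq_sqrt h1]
    ring⟩
  continuous_toFun := by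
    refine Continuous.subtype_mk ?_ _
    exact continuous_consE.comp (Continuous.prodMk (by fun_prop) (by fun_prop))

/-- The map to the one-point space. -/
abbrev toPt (X : Type*) [TopologicalSpace X] : C(X, PUnit.{1}) := .const X ⟨⟩

/-- The map from the one-point space to a point. -/
abbrev pt {X : Type*} [TopologicalSpace X] (x : X) : C(PUnit.{1}, X) := .const _ x

/-- The sphere is obtained from the disc by collapsing the boundary. -/
lemma sphere_isTopPushout (k : ℕ) : IsTopPushout (toPt (discBoundary (Euc k)))
    (incl (discBoundary (Euc k))) (pt (spherePoint k)) (discToSphere k) := by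
  have hB : ∀ z : Disc (Euc k), ‖(z : Euc k)‖ = 1 → discToSphere k z = spherePoint k := by
    intro z hz
    ext1
    simp only [discToSphere, ContinuousMap.coe_mk, hz, spherePoint, ← consE_one_zero]
    norm_num
  have hI : ∀ z z' : Disc (Euc k), discToSphere k z = discToSphere k z' →
      ‖(z : Euc k)‖ = ‖(z' : Euc k)‖ ∧ (‖(z : Euc k)‖ ≠ 1 → z = z') := by
    intro z z' h
    obtain ⟨h1, h2⟩ := consE_inj (congrArg Subtype.val h)
    have h3 : ‖(z : Euc k)‖ = ‖(z' : Euc k)‖ := by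
      rw [← sq_eq_sq₀ (norm_nonneg _) (norm_nonneg _)]
      linarith
    refine ⟨h3, fun hz => ?_⟩
    have h4 : 0 < 1 - ‖(z : Euc k)‖ ^ 2 := by
      have := lt_of_le_of_ne z.norm_le hz
      nlinarith [norm_nonneg (z : Euc k)]
    rw [← h3] at h2
    have h5 : 2 * √(1 - ‖(z : Euc k)‖ ^ 2) ≠ 0 := by
      have := Real.sqrt_pos.2 h4
      positivity
    exact Subtype.ext (smul_right_injective _ h5 h2)
  refine IsTopPushout.of_compact (fun c => (hB c c.2).symm) ?_ (fun _ _ _ => rfl) ?_ ?_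
  · rintro ⟨x, hx⟩
    obtain ⟨a, v, rfl⟩ := exists_consE x
    have hav : a ^ 2 + ‖v‖ ^ 2 = 1 := by
      rw [← norm_consE_sq, mem_sphere_zero_iff_norm.1 hx, one_pow]
    by_cases ha : a = 1
    · left
      refine ⟨⟨⟩, Subtype.ext ?_⟩
      have : v = 0 := by
        have : ‖v‖ ^ 2 = 0 := by rw [ha] at hav; linarith
        simpa using this
      simp [spherePoint, ha, this, consE_one_zero]
    · right
      have ha1 : a < 1 := lt_of_le_of_ne (by nlinarith [sq_nonneg ‖v‖]) ha
      have ha2 : -1 ≤ a := by nlinarith [sq_nonneg ‖v‖]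
      have hpos : 0 < 2 * √((1 - a) / 2) := by
        have := Real.sqrt_pos.2 (show 0 < (1 - a) / 2 by linarith)
        positivity
      have hsq : (2 * √((1 - a) / 2)) ^ 2 = 2 * (1 - a) := by
        rw [mul_pow, Real.sq_sqrt (by linarith)]; ring
      have hn : ‖(2 * √((1 - a) / 2))⁻¹ • v‖ ^ 2 = (1 + a) / 2 := by
        rw [norm_smul, mul_pow, norm_inv, Real.norm_of_nonneg hpos.le, inv_pow, hsq]
        have h1 : 1 - a ≠ 0 := by linarith
        have : ‖v‖ ^ 2 = (1 - a) * (1 + a) := by linarith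
        rw [this]
        field_simp
      refine ⟨⟨(2 * √((1 - a) / 2))⁻¹ • v, ?_⟩, Subtype.ext ?_⟩
      · rw [mem_closedBall_zero_iff, ← sq_le_one_iff₀ (norm_nonneg _), hn]
        linarith
      · simp only [discToSphere, ContinuousMap.coe_mk, hn]
        rw [show 1 - (1 + a) / 2 = (1 - a) / 2 by ring, smul_inv_smul₀ hpos.ne']
        congr 1
        ring
  · intro z z' h
    obtain ⟨h1, h2⟩ := hI z z' h
    by_cases hz : ‖(z : Euc k)‖ = 1
    · exact Or.inr ⟨⟨z, hz⟩, ⟨z', h1.symm.trans hz⟩, rfl, rfl, rfl⟩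
    · exact Or.inl (h2 hz)
  · rintro ⟨⟩ z h
    refine ⟨⟨z, ?_⟩, rfl, rfl⟩
    have := (consE_inj (((congrArg Subtype.val h).symm).trans consE_one_zero.symm)).1
    have h1 : ‖(z : Euc k)‖ ^ 2 = 1 := by linarith
    exact (pow_eq_one_iff_of_nonneg (norm_nonneg _) two_ne_zero).1 h1

lemma hep_spherePoint (k : ℕ) : HEP (pt (spherePoint k)) :=
  (sphere_isTopPushout k).hep (isNDR_discBoundary _).hep

/-- The unit circle, as the boundary of the disc. -/
abbrev Circ : Type := discBoundary ℂ

/-- The map `(a, z) ↦ (z, √(1 - ‖z‖²) a)` onto the sphere. -/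
noncomputable def joinToSphere (k : ℕ) : C(discBoundary (Euc k) × Disc ℂ, Sphere (k + 1)) where
  toFun p := ⟨consE (p.2 : ℂ).re (consE (p.2 : ℂ).im (√(1 - ‖(p.2 : ℂ)‖ ^ 2) • (p.1 : Euc k))), by
    have h := p.2.norm_le
    have h1 : 0 ≤ 1 - ‖(p.2 : ℂ)‖ ^ 2 := by nlinarith [norm_nonneg (p.2 : ℂ)]
    have h2 : ‖((p.1 : Disc (Euc k)) : Euc k)‖ = 1 := p.1.2
    have h3 : ‖(p.2 : ℂ)‖ ^ 2 = (p.2 : ℂ).re ^ 2 + (p.2 : ℂ).im ^ 2 := by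
      rw [← Complex.normSq_eq_norm_sq, Complex.normSq_apply]; ring
    rw [mem_sphere_zero_iff_norm, ← sq_eq_sq₀ (norm_nonneg _) zero_le_one, norm_consE_sq,
      norm_consE_sq, norm_smul, mul_pow, Real.norm_eq_abs, sq_abs, Real.sq_sqrt h1, h2, h3]
    ring⟩
  continuous_toFun := by
    refine Continuous.subtype_mk ?_ _
    refine continuous_consE.comp (Continuous.prodMk (by fun_prop) ?_)
    exact continuous_consE.comp (Continuous.prodMk (by fun_prop) (by fun_prop))

/-- The inclusion of the circle of the first two coordinates. -/
noncomputable def circToSphere (k : ℕ) : C(Circ, Sphere (k + 1)) where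
  toFun w := ⟨consE (w : ℂ).re (consE (w : ℂ).im 0), by
    have h2 : ‖((w : Disc ℂ) : ℂ)‖ = 1 := w.2
    rw [mem_sphere_zero_iff_norm, ← sq_eq_sq₀ (norm_nonneg _) zero_le_one, norm_consE_sq,
      norm_consE_sq, norm_zero, one_pow]
    rw [← sq_eq_sq₀ (norm_nonneg _) zero_le_one, one_pow, ← Complex.normSq_eq_norm_sq,
      Complex.normSq_apply] at h2
    linarith⟩
  continuous_toFun := by
    refine Continuous.subtype_mk ?_ _
    refine continuous_consE.comp (Continuous.prodMk (by fun_prop) ?_)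
    exact continuous_consE.comp (Continuous.prodMk (by fun_prop) (by fun_prop))

/-- The norm of `z` is the join coordinate: `a` is forgotten exactly when `z` lies on the circle. -/
lemma join_isTopPushout (k : ℕ) : IsTopPushout
    (ContinuousMap.snd : C(discBoundary (Euc k) × Circ, Circ))
    ((ContinuousMap.id (discBoundary (Euc k))).prodMap (incl (discBoundary ℂ)))
    (circToSphere k) (joinToSphere k) := by
  have hz : ∀ z w : Disc ℂ, (z : ℂ).re = (w : ℂ).re → (z : ℂ).im = (w : ℂ).im → z = w :=
    fun z w h1 h2 => Subtype.ext (Complex.ext h1 h2)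
  have : CompactSpace Circ := isCompact_iff_compactSpace.1 (isNDR_discBoundary ℂ).isClosed.isCompact
  have : CompactSpace (discBoundary (Euc k)) :=
    isCompact_iff_compactSpace.1 (isNDR_discBoundary (Euc k)).isClosed.isCompact
  refine IsTopPushout.of_compact ?_ ?_ ?_ ?_ ?_
  · rintro ⟨a, w⟩
    have h2 : ‖((w : Disc ℂ) : ℂ)‖ = 1 := w.2
    ext1
    simp [circToSphere, joinToSphere, h2]
  · rintro ⟨x, hx⟩
    obtain ⟨a, x, rfl⟩ := exists_consE x
    obtain ⟨b, v, rfl⟩ := exists_consE x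
    have hn : a ^ 2 + (b ^ 2 + ‖v‖ ^ 2) = 1 := by
      rw [← norm_consE_sq, ← norm_consE_sq, mem_sphere_zero_iff_norm.1 hx, one_pow]
    have hab : ‖(⟨a, b⟩ : ℂ)‖ ^ 2 = 1 - ‖v‖ ^ 2 := by
      rw [← Complex.normSq_eq_norm_sq, Complex.normSq_apply]; linarith
    have hle : ‖(⟨a, b⟩ : ℂ)‖ ≤ 1 := by
      rw [← sq_le_one_iff₀ (norm_nonneg _), hab]
      nlinarith [sq_nonneg ‖v‖]
    by_cases hv : v = 0
    · left
      refine ⟨⟨⟨⟨a, b⟩, mem_closedBall_zero_iff.2 hle⟩, ?_⟩, ?_⟩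
      · rw [hv] at hab
        exact (pow_eq_one_iff_of_nonneg (norm_nonneg _) two_ne_zero).1 (by simpa using hab)
      · ext1
        simp [circToSphere, hv]
    · right
      have hv' : ‖v‖ ≠ 0 := norm_ne_zero_iff.2 hv
      have h1 : ‖‖v‖⁻¹ • v‖ = 1 := by
        rw [norm_smul, norm_inv, norm_norm, inv_mul_cancel₀ hv']
      refine ⟨(⟨⟨‖v‖⁻¹ • v, mem_closedBall_zero_iff.2 h1.le⟩, h1⟩,
        ⟨⟨a, b⟩, mem_closedBall_zero_iff.2 hle⟩), ?_⟩
      ext1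
      simp only [joinToSphere, ContinuousMap.coe_mk, hab]
      rw [sub_sub_cancel, Real.sqrt_sq (norm_nonneg _), smul_inv_smul₀ hv']
  · intro w w' h
    obtain ⟨h1, h2⟩ := consE_inj (congrArg Subtype.val h)
    exact Subtype.ext (hz _ _ h1 (consE_inj h2).1)
  · rintro ⟨a, z⟩ ⟨a', z'⟩ h
    obtain ⟨h1, h2⟩ := consE_inj (congrArg Subtype.val h)
    obtain ⟨h2, h3⟩ := consE_inj h2
    obtain rfl : z = z' := hz _ _ h1 h2
    by_cases hz1 : ‖(z : ℂ)‖ = 1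
    · exact Or.inr ⟨(a, ⟨z, hz1⟩), (a', ⟨z, hz1⟩), rfl, rfl, rfl⟩
    · left
      have h4 : 0 < 1 - ‖(z : ℂ)‖ ^ 2 := by
        have := lt_of_le_of_ne z.norm_le hz1
        nlinarith [norm_nonneg (z : ℂ)]
      have h5 := smul_right_injective _ (Real.sqrt_pos.2 h4).ne' h3
      exact Prod.ext (Subtype.ext (Subtype.ext h5)) rfl
  · rintro w ⟨a, z⟩ h
    obtain ⟨h1, h2⟩ := consE_inj (congrArg Subtype.val h)
    obtain ⟨h2, -⟩ := consE_inj h2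
    exact ⟨(a, w), rfl, Prod.ext rfl (hz _ _ h1 h2)⟩

/-- The join of a space with the circle. -/
abbrev Join (B : Type) [TopologicalSpace B] : Type :=
  HoPushout (ContinuousMap.snd : C(B × Circ, Circ)) (ContinuousMap.fst : C(B × Circ, B))

lemma join_discBoundary_hEquiv (k : ℕ) : HEquiv (Join (discBoundary (Euc k))) (Sphere (k + 1)) :=
  (HoPushout.hEquiv_mapRight _ _ (isHEq_fst (Y := Disc ℂ))).symm.trans
    ((join_isTopPushout k).hEquiv ((isNDR_discBoundary ℂ).hep_prod' _))

/-- The circle in the Euclidean plane. -/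
noncomputable def circHomeo : Circ ≃ₜ discBoundary (Euc 2) :=
  (Complex.orthonormalBasisOneI.repr.toHomeomorph.subtype (p := fun z => z ∈ Metric.closedBall 0 1)
    (q := fun z => z ∈ Metric.closedBall 0 1) (by simp)).subtype (by simp)

lemma Join.congr {B B' : Type} [TopologicalSpace B] [TopologicalSpace B'] (h : HEquiv B B') :
    HEquiv (Join B) (Join B') := by
  obtain ⟨β, hβ⟩ := h.exists_isHEq
  exact (HoPushout.hEquiv_mapRight _ _ hβ).trans
    (HoPushout.hEquiv_mapMid ContinuousMap.snd ContinuousMap.fst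
      (hβ.prodMap (isHEq_id (X := Circ))))

lemma join_circ_hEquiv : HEquiv (Join Circ) (Sphere 3) :=
  (Join.congr circHomeo.hEquiv).trans (join_discBoundary_hEquiv 2)

lemma sphere_pathConnectedSpace {k : ℕ} (hk : 1 ≤ k) : PathConnectedSpace (Sphere k) := by
  refine isPathConnected_iff_pathConnectedSpace.1 (isPathConnected_sphere ?_ 0 zero_le_one)
  rw [← Module.finrank_eq_rank]
  simp
  exact_mod_cast hk

end Spheres
end PolyProd

namespace PolyProd

open Topology

/-! ### Wedges of spheres indexed by lists of dimensions -/

section WedgeOfSpheres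

/-- The wedge of the spheres whose dimensions are listed in `L`. -/
abbrev WedgeList (L : List ℕ) : Type :=
  Wedge (fun i : Fin L.length => Sphere (L.get i)) (fun i => spherePoint (L.get i))

/-- The projection from the disjoint union onto the wedge. -/
def Wedge.mk {ι : Type*} (Y : ι → Type*) (y : ∀ i, Y i) (x : Unit ⊕ Σ i, Y i) : Wedge Y y :=
  Quotient.mk _ x

lemma Wedge.continuous_mk {ι : Type*} (Y : ι → Type*) (y : ∀ i, Y i)
    [∀ i, TopologicalSpace (Y i)] : Continuous (Wedge.mk Y y) := continuous_quotient_mk'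

lemma Wedge.mk_point {ι : Type*} (Y : ι → Type*) (y : ∀ i, Y i) (i : ι) :
    Wedge.mk Y y (Sum.inr ⟨i, y i⟩) = Wedge.mk Y y (Sum.inl ()) :=
  Quotient.sound (Or.inr ⟨Or.inr ⟨i, rfl⟩, Or.inl ⟨(), rfl⟩⟩)

/-- The map out of a wedge that is given by maps out of the summands. -/
def Wedge.lift {ι Z : Type*} (Y : ι → Type*) (y : ∀ i, Y i) [∀ i, TopologicalSpace (Y i)]
    [TopologicalSpace Z] (z : Z) (f : ∀ i, C(Y i, Z)) (h : ∀ i, f i (y i) = z) :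
    C(Wedge Y y, Z) where
  toFun := Quotient.lift (Sum.elim (fun _ => z) fun x => f x.1 x.2) (by
    have key : ∀ p, p ∈ Set.range (Sum.inl : Unit → Unit ⊕ Σ i, Y i) ∪
        Set.range (fun i => (Sum.inr ⟨i, y i⟩ : Unit ⊕ Σ i, Y i)) →
        Sum.elim (fun _ => z) (fun x : Σ i, Y i => f x.1 x.2) p = z := by
      rintro _ (⟨_, rfl⟩ | ⟨i, rfl⟩)
      · rfl
      · exact h i
    rintro p q (e | ⟨hp, hq⟩)
    · rw [e]
    · exact (key p hp).trans (key q hq).symm)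
  continuous_toFun := Continuous.quotient_lift
    (continuous_const.sumElim (continuous_sigma fun i => (f i).continuous)) _

/-- The base point of a wedge. -/
def Wedge.base {ι : Type*} (Y : ι → Type*) (y : ∀ i, Y i) : Wedge Y y := Wedge.mk Y y (Sum.inl ())

/-- The inclusion of a summand into a wedge. -/
def Wedge.ι {ι : Type*} (Y : ι → Type*) (y : ∀ i, Y i) [∀ i, TopologicalSpace (Y i)] (i : ι) :
    C(Y i, Wedge Y y) :=
  ⟨fun x => Wedge.mk Y y (Sum.inr ⟨i, x⟩), (Wedge.continuous_mk Y y).comp (by fun_prop)⟩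

section
variable {ι : Type*} {Y : ι → Type*} {y : ∀ i, Y i} [∀ i, TopologicalSpace (Y i)]

@[simp] lemma Wedge.ι_point (i : ι) : Wedge.ι Y y i (y i) = Wedge.base Y y := Wedge.mk_point Y y i

lemma Wedge.cases {p : Wedge Y y → Prop} (hb : p (Wedge.base Y y))
    (hι : ∀ i x, p (Wedge.ι Y y i x)) (w : Wedge Y y) : p w := by
  induction w using Quotient.ind with
  | _ w =>
    rcases w with ⟨⟩ | ⟨i, x⟩
    · exact hb
    · exact hι i x

end

/-- Reindexing a wedge of spheres. -/
lemma Wedge.hEquiv_of_equiv {ι κ : Type} (e : ι ≃ κ) (m : ι → ℕ) (n : κ → ℕ)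
    (h : ∀ i, n (e i) = m i) :
    HEquiv (Wedge (fun i => Sphere (m i)) fun i => spherePoint (m i))
      (Wedge (fun i => Sphere (n i)) fun i => spherePoint (n i)) := by
  obtain rfl : n ∘ e = m := funext h
  let s : (Σ i, Sphere (n (e i))) ≃ₜ Σ j, Sphere (n j) :=
    (e.sigmaCongrLeft (β := fun j => Sphere (n j))).toHomeomorphOfContinuousOpen
      (continuous_sigma fun i => continuous_sigmaMk (σ := fun j => Sphere (n j)) (i := e i))
      (isOpenMap_sigma.2 fun i => isOpenMap_sigmaMk (σ := fun j => Sphere (n j)) (i := e i))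
  let W := Wedge (fun j => Sphere (n j)) fun j => spherePoint (n j)
  let W' := Wedge (fun i => Sphere (n (e i))) fun i => spherePoint (n (e i))
  have hs : ∀ i x, s ⟨i, x⟩ = ⟨e i, x⟩ := fun _ _ => rfl
  have hs' : ∀ i x, s.symm ⟨e i, x⟩ = ⟨i, x⟩ := fun i x => by
    rw [← hs, s.symm_apply_apply]
  let φ : C(W', W) := Wedge.lift (fun i => Sphere (n (e i))) (fun i => spherePoint (n (e i)))
    (Wedge.base _ _) (fun i => Wedge.ι (fun j => Sphere (n j)) (fun j => spherePoint (n j)) (e i))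
    fun i => Wedge.ι_point (Y := fun j => Sphere (n j)) (y := fun j => spherePoint (n j)) (e i)
  -- Going through `s.symm` avoids casts between spheres whose dimensions are only propositionally
  -- equal.
  let ψ : C(W, W') := Wedge.lift _ _ (Wedge.base _ _)
    (fun j => ⟨fun x => Wedge.mk _ _ (Sum.inr (s.symm ⟨j, x⟩)), (Wedge.continuous_mk _ _).comp
      (continuous_inr.comp (s.symm.continuous.comp continuous_sigmaMk))⟩) (by
      intro j
      obtain ⟨i, rfl⟩ := e.surjective j
      simp only [ContinuousMap.coe_mk, hs']
      exact Wedge.mk_point _ _ i)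
  have h1 : ψ.comp φ = .id _ := by
    ext x
    induction x using Wedge.cases with
    | hb => rfl
    | hι i x =>
      change Wedge.mk _ _ (Sum.inr (s.symm ⟨e i, x⟩)) = _
      rw [hs']
      rfl
  have h2 : φ.comp ψ = .id _ := by
    ext x
    induction x using Wedge.cases with
    | hb => rfl
    | hι j x =>
      obtain ⟨i, rfl⟩ := e.surjective j
      change φ (Wedge.mk _ _ (Sum.inr (s.symm ⟨e i, x⟩))) = _
      rw [hs']
      rfl
  exact ⟨⟨φ, ψ, by rw [h1]; exact .refl _, by rw [h2]⟩⟩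

/-- The base point of a wedge of spheres. -/
noncomputable abbrev WedgeList.base (L : List ℕ) : WedgeList L := Wedge.base _ _

instance : ContractibleSpace (WedgeList []) := by
  have : Subsingleton (WedgeList []) := by
    refine ⟨fun x y => ?_⟩
    have key : ∀ z : WedgeList [], z = WedgeList.base [] := by
      intro z
      induction z using Wedge.cases with
      | hb => rfl
      | hι i => exact i.elim0
    rw [key x, key y]
  have : Nonempty (WedgeList []) := ⟨WedgeList.base []⟩
  infer_instance

lemma WedgeList.pathConnectedSpace {L : List ℕ} (hL : ∀ k ∈ L, 1 ≤ k) :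
    PathConnectedSpace (WedgeList L) := by
  have key : ∀ z, Joined (WedgeList.base L) z := by
    intro z
    induction z using Wedge.cases with
    | hb => exact Joined.refl _
    | hι i x =>
      have := sphere_pathConnectedSpace (hL _ (L.get_mem i))
      have h := (PathConnectedSpace.joined (spherePoint (L.get i)) x).map
        (Wedge.ι (fun i : Fin L.length => Sphere (L.get i)) (fun _ => spherePoint _) i).continuous
      rwa [Wedge.ι_point] at h
  exact ⟨⟨WedgeList.base L⟩, fun x y => (key x).symm.trans (key y)⟩

/-- The inclusion of a wedge of spheres into the wedge with one more sphere. -/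
noncomputable def WedgeList.tail (k : ℕ) (L : List ℕ) : C(WedgeList L, WedgeList (k :: L)) :=
  Wedge.lift _ _ (WedgeList.base _) (fun i => Wedge.ι (fun i : Fin (k :: L).length =>
    Sphere ((k :: L).get i)) (fun _ => spherePoint _) i.succ) fun _ => Wedge.ι_point _

/-- The inclusion of the first sphere into a wedge of spheres. -/
noncomputable def WedgeList.head (k : ℕ) (L : List ℕ) : C(Sphere k, WedgeList (k :: L)) :=
  Wedge.ι (fun i : Fin (k :: L).length => Sphere ((k :: L).get i)) (fun _ => spherePoint _)
    (0 : Fin (L.length + 1))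

lemma WedgeList.isTopPushout (k : ℕ) (L : List ℕ) : IsTopPushout (pt (WedgeList.base L))
    (pt (spherePoint k)) (WedgeList.tail k L) (WedgeList.head k L) where
  comm := fun _ => (Wedge.ι_point (Y := fun i : Fin (k :: L).length => Sphere ((k :: L).get i))
    (y := fun _ => spherePoint _) (0 : Fin (L.length + 1))).symm
  surj := by
    intro x
    induction x using Wedge.cases with
    | hb => exact Or.inl ⟨WedgeList.base L, rfl⟩
    | hι i x =>
      revert x
      refine Fin.cases ?_ (fun i => ?_) i
      · exact fun x => Or.inr ⟨x, rfl⟩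
      · exact fun x => Or.inl ⟨Wedge.ι (fun i : Fin L.length => Sphere (L.get i))
          (fun _ => spherePoint _) i x, rfl⟩
  desc := by
    intro Z _ a b hab
    have hab : a (WedgeList.base L) = b (spherePoint k) := hab ⟨⟩
    refine ⟨Wedge.lift _ _ (a (WedgeList.base L)) (Fin.cases b fun i => a.comp (Wedge.ι
      (fun i : Fin L.length => Sphere (L.get i)) (fun _ => spherePoint _) i)) ?_, ?_, ?_⟩
    · refine Fin.cases hab.symm fun i => ?_
      exact congrArg a (Wedge.ι_point (Y := fun i : Fin L.length => Sphere (L.get i))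
        (y := fun _ => spherePoint _) i)
    · intro x
      induction x using Wedge.cases <;> rfl
    · intro x
      rfl

end WedgeOfSpheres

/-! ### One-point unions up to homotopy -/

section OnePointUnions

variable {X Y S T : Type} [TopologicalSpace X] [TopologicalSpace Y] [TopologicalSpace S]
  [TopologicalSpace T]

lemma homotopic_of_pathConnected [PathConnectedSpace X] (f g : C(PUnit.{1}, X)) :
    f.Homotopic g := by
  have : f = pt (f ⟨⟩) := by ext; rfl
  rw [this]
  have : g = pt (g ⟨⟩) := by ext; rfl
  rw [this]
  exact homotopic_const_of_joined (PathConnectedSpace.joined _ _)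

/-- One-point unions are homotopy invariant. -/
lemma hEquiv_onePointUnion [PathConnectedSpace S] [PathConnectedSpace T] (x : C(PUnit.{1}, X))
    (y : C(PUnit.{1}, Y)) (s : C(PUnit.{1}, S)) (t : C(PUnit.{1}, T)) (h : HEquiv X S)
    (h' : HEquiv Y T) : HEquiv (HoPushout x y) (HoPushout s t) := by
  obtain ⟨φ, hφ⟩ := h.exists_isHEq
  obtain ⟨ψ, hψ⟩ := h'.exists_isHEq
  exact (((HoPushout.hEquiv_mapLeft _ _ hφ).trans (HoPushout.hEquiv_mapRight _ _ hψ)).trans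
    (HoPushout.hEquiv_of_homotopic_left _ (homotopic_of_pathConnected _ s))).trans
    (HoPushout.hEquiv_of_homotopic_right _ (homotopic_of_pathConnected _ t))

/-- Both sides attach `X` and `T` to `S` at the same point; pasting is applied to each bracketing.
-/
lemma hEquiv_onePointUnion_assoc (x : C(PUnit.{1}, X)) (s : C(PUnit.{1}, S)) (t : C(PUnit.{1}, T)) :
    HEquiv (HoPushout x ((HoPushout.inl s t).comp s))
      (HoPushout ((HoPushout.inl s x).comp s) t) :=
  (HoPushout.hEquiv_swap _ _).trans <| (HoPushout.hEquiv_paste _ _ _).trans <|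
    (HoPushout.hEquiv_swap _ _).trans (HoPushout.hEquiv_paste _ _ _).symm

lemma pathConnectedSpace_onePointUnion [PathConnectedSpace X] [PathConnectedSpace Y]
    (x : C(PUnit.{1}, X)) (y : C(PUnit.{1}, Y)) : PathConnectedSpace (HoPushout x y) := by
  have hg : ∀ t c, Joined (HoPushout.inl x y (x ⟨⟩)) (HoPushout.glue x y (t, c)) := by
    intro t c
    exact ⟨⟨⟨fun s => HoPushout.glue x y (s * t, c), by fun_prop⟩,
      by simp, by simp⟩⟩
  have key : ∀ z, Joined (HoPushout.inl x y (x ⟨⟩)) z := by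
    intro z
    induction z using HoPushout.cases with
    | hl a => exact (PathConnectedSpace.joined _ _).map (HoPushout.inl x y).continuous
    | hr b =>
      have := hg 1 ⟨⟩
      rw [HoPushout.glue_one] at this
      exact this.trans ((PathConnectedSpace.joined _ _).map (HoPushout.inr x y).continuous)
    | hg c => exact hg c.1 c.2
  exact ⟨⟨HoPushout.inl x y (x ⟨⟩)⟩, fun a b => (key a).symm.trans (key b)⟩

/-- Adding a sphere to a wedge of spheres. -/
lemma WedgeList.hEquiv_cons {k : ℕ} {L : List ℕ} (hk : 1 ≤ k) (hL : ∀ j ∈ L, 1 ≤ j)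
    (h : HEquiv X (WedgeList L)) (h' : HEquiv Y (Sphere k)) (x : C(PUnit.{1}, X))
    (y : C(PUnit.{1}, Y)) : HEquiv (HoPushout x y) (WedgeList (k :: L)) := by
  have := sphere_pathConnectedSpace hk
  have := WedgeList.pathConnectedSpace hL
  exact (hEquiv_onePointUnion x y _ _ h h').trans
    ((WedgeList.isTopPushout k L).hEquiv (hep_spherePoint k))

lemma sphere_hEquiv_wedgeList (k : ℕ) : HEquiv (Sphere k) (WedgeList [k]) :=
  (HoPushout.hEquiv_of_isHEq (isHEq_of_contractible (pt (WedgeList.base [])))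
    (pt (spherePoint k))).symm.trans ((WedgeList.isTopPushout k []).hEquiv (hep_spherePoint k))

end OnePointUnions
end PolyProd

namespace PolyProd

open Topology

/-! ### The moment-angle complex of disjoint points -/

section Calculation

instance : CompactSpace Circ :=
  isCompact_iff_compactSpace.1 (isNDR_discBoundary ℂ).isClosed.isCompact

lemma discBoundary_complex_nonempty : (discBoundary ℂ).Nonempty :=
  ⟨⟨1, by simp⟩, by simp⟩

instance : Nonempty Circ := discBoundary_complex_nonempty.to_subtype

/-- The half-smash product of a sphere with the circle is the wedge of two spheres. -/
lemma halfSmash_hEquiv {k : ℕ} (hk : 1 ≤ k)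
    (s : C(PUnit.{1}, Sphere k)) (t : C(PUnit.{1}, Sphere (k + 1))) :
    HEquiv (HoPushout (toPt (PUnit.{1} × Circ)) ((pt (spherePoint k)).prodMap (.id Circ)))
      (HoPushout s t) := by
  have := sphere_pathConnectedSpace hk
  have := sphere_pathConnectedSpace (show 1 ≤ k + 1 by omega)
  let B := discBoundary (Euc k)
  obtain ⟨w⟩ := (inferInstance : Nonempty Circ)
  -- Writing `S^k × S¹` as a pushout over `B × S¹` and pasting leaves the homotopy pushout of `pt ←
  -- B × S¹ → D × S¹`.
  obtain ⟨π, hπ, hl, -⟩ := ((sphere_isTopPushout k).prod Circ).exists_isHEq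
    ((isNDR_discBoundary (Euc k)).hep_prod Circ)
  have e1 : (pt (spherePoint k)).prodMap (.id Circ) = π.comp (HoPushout.inl _ _) := by
    ext1 x
    exact (hl x).symm
  rw [e1]
  refine (HoPushout.hEquiv_mapRight _ _ hπ).symm.trans ?_
  refine (HoPushout.hEquiv_paste _ _ _).symm.trans ?_
  refine (HoPushout.hEquiv_mapRight _ _ (isHEq_snd (Y := Disc (Euc k)) (X := Circ))).trans ?_
  -- The map `B × S¹ → pt` factors through `B`, so this is the cofibre of `B → B * S¹`. That map is
  -- nullhomotopic, so the cofibre splits as the suspension of `B`, which is `S^k`, and the join,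
  -- which is `S^(k+1)`.
  refine (HoPushout.hEquiv_paste (ContinuousMap.fst : C(B × Circ, B))
    (ContinuousMap.snd : C(B × Circ, Circ)) (toPt B)).trans ?_
  let J := HoPushout (ContinuousMap.fst : C(B × Circ, B)) (ContinuousMap.snd : C(B × Circ, Circ))
  let x₀ : J := HoPushout.inr _ _ w
  have hn : (HoPushout.inl (ContinuousMap.fst : C(B × Circ, B))
      (ContinuousMap.snd : C(B × Circ, Circ))).Homotopic ((pt x₀).comp (toPt B)) :=
    HoPushout.inl_nullhomotopic _ _ (.id B) ⟨fun a => (a, w), by fun_prop⟩ w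
      (fun _ => rfl) (fun _ => rfl)
  refine (HoPushout.hEquiv_of_homotopic_right _ hn).trans ?_
  refine (HoPushout.hEquiv_swap _ _).trans ?_
  refine (HoPushout.hEquiv_paste _ _ _).trans ?_
  refine (HoPushout.hEquiv_swap _ _).trans ?_
  refine hEquiv_onePointUnion _ _ _ _ ?_ ?_
  · refine HEquiv.trans ?_ ((sphere_isTopPushout k).hEquiv (isNDR_discBoundary _).hep)
    exact (HoPushout.hEquiv_mapRight _ _ (isHEq_of_contractible (toPt (Disc (Euc k))))).symm
  · exact (HoPushout.hEquiv_swap _ _).trans (join_discBoundary_hEquiv k)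

/-- The homotopy pushout of `A × S¹ ← B × S¹ → B`, where the left map is constant in the first
coordinate. -/
abbrev HalfJoin {A : Type} [TopologicalSpace A] (a : A) (B : Type) [TopologicalSpace B] : Type :=
  HoPushout ((ContinuousMap.const B a).prodMap (.id Circ)) (ContinuousMap.fst : C(B × Circ, B))

variable {A B : Type} [TopologicalSpace A] [TopologicalSpace B]

lemma HalfJoin.congr {A' : Type} [TopologicalSpace A'] [PathConnectedSpace A'] (a : A) (a' : A')
    (B : Type) [TopologicalSpace B] (h : HEquiv A A') : HEquiv (HalfJoin a B) (HalfJoin a' B) := by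
  obtain ⟨φ, hφ⟩ := h.exists_isHEq
  refine (HoPushout.hEquiv_mapLeft _ _ (hφ.prodMap (isHEq_id (X := Circ)))).trans ?_
  exact HoPushout.hEquiv_of_homotopic_left _ ((homotopic_const_of_joined
    (PathConnectedSpace.joined (φ a) a')).prodMap (.refl (.id Circ)))

lemma HalfJoin.hEquiv_join [ContractibleSpace A] (a : A) : HEquiv (HalfJoin a B) (Join B) :=
  HoPushout.hEquiv_mapLeft _ _ (isHEq_snd (Y := A) (X := Circ))

/-- The dimensions of the spheres in the half join of a wedge of spheres. -/
def halfJoinDims : List ℕ → List ℕ → List ℕ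
  | [], E => E
  | k :: L, E => k :: (k + 1) :: halfJoinDims L E

lemma one_le_of_mem_halfJoinDims {L E : List ℕ} (hL : ∀ j ∈ L, 1 ≤ j) (hE : ∀ j ∈ E, 1 ≤ j) :
    ∀ j ∈ halfJoinDims L E, 1 ≤ j := by
  induction L with
  | nil => exact hE
  | cons k L ih =>
    have ih := ih fun j hj => hL j (List.mem_cons_of_mem _ hj)
    intro j hj
    simp only [halfJoinDims, List.mem_cons] at hj
    rcases hj with rfl | rfl | hj
    · exact hL _ List.mem_cons_self
    · omega
    · exact ih j hj

/-- Adding `S^k` to the wedge glues `S^k × S¹` onto the half join along a circle. The circle is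
nullhomotopic there, so a half-smash product, that is `S^k ∨ S^(k+1)`, splits off. For the empty
wedge the half join is the join. -/
lemma HalfJoin.hEquiv_wedgeList [Nonempty B] {L E : List ℕ} (hL : ∀ j ∈ L, 1 ≤ j)
    (hE : ∀ j ∈ E, 1 ≤ j) (h : HEquiv (Join B) (WedgeList E)) :
    HEquiv (HalfJoin (WedgeList.base L) B) (WedgeList (halfJoinDims L E)) := by
  induction L with
  | nil => exact (HalfJoin.hEquiv_join _).trans h
  | cons k L ih =>
    have hL' : ∀ j ∈ L, 1 ≤ j := fun j hj => hL j (List.mem_cons_of_mem _ hj)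
    have hk : 1 ≤ k := hL k List.mem_cons_self
    have ih := ih hL'
    have hD := one_le_of_mem_halfJoinDims hL' hE
    have := WedgeList.pathConnectedSpace hD
    have := sphere_pathConnectedSpace hk
    have := sphere_pathConnectedSpace (show 1 ≤ k + 1 by omega)
    obtain ⟨b⟩ := ‹Nonempty B›
    let M := HalfJoin (WedgeList.base L) B
    let m : M := HoPushout.inr _ _ b
    have hep : HEP ((pt (spherePoint k)).prodMap (.id Circ)) :=
      ((sphere_isTopPushout k).prod Circ).hep ((isNDR_discBoundary (Euc k)).hep_prod Circ)
    obtain ⟨π, hπ, hl, -⟩ := ((WedgeList.isTopPushout k L).prod Circ).exists_isHEq hep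
    have e1 : (WedgeList.tail k L).prodMap (.id Circ) = π.comp (HoPushout.inl _ _) := by
      ext1 x
      exact (hl x).symm
    refine (HoPushout.hEquiv_paste ((ContinuousMap.const B (WedgeList.base L)).prodMap (.id Circ))
      (ContinuousMap.fst : C(B × Circ, B)) ((WedgeList.tail k L).prodMap (.id Circ))).trans ?_
    rw [e1]
    refine (HoPushout.hEquiv_mapLeft _ _ hπ).symm.trans ?_
    refine (HoPushout.hEquiv_swap _ _).trans ?_
    refine (HoPushout.hEquiv_paste _ _ _).symm.trans ?_
    -- The circle over the base point is the image of `{b} × S¹`, which the cylinder contracts to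
    -- `b`.
    have hn : ((HoPushout.inl ((ContinuousMap.const B (WedgeList.base L)).prodMap (.id Circ))
        (ContinuousMap.fst : C(B × Circ, B))).comp
        ((pt (WedgeList.base L)).prodMap (.id Circ))).Homotopic
        ((pt m).comp (toPt (PUnit.{1} × Circ))) :=
      HoPushout.inl_nullhomotopic _ _ _ ⟨fun x => (b, x.2), by fun_prop⟩ b
        (fun _ => rfl) (fun _ => rfl)
    refine (HoPushout.hEquiv_of_homotopic_left _ hn).trans ?_
    refine (HoPushout.hEquiv_paste _ _ _).trans ?_
    let s := pt (spherePoint k)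
    let t := pt (spherePoint (k + 1))
    have := pathConnectedSpace_onePointUnion t s
    refine (hEquiv_onePointUnion _ _ (pt (WedgeList.base _)) ((HoPushout.inl t s).comp t) ih
      ((halfSmash_hEquiv hk s t).trans (HoPushout.hEquiv_swap _ _))).trans ?_
    refine (hEquiv_onePointUnion_assoc _ _ _).trans ?_
    refine WedgeList.hEquiv_cons hk ?_ ?_ (.refl _) _ _
    · intro j hj
      rcases List.mem_cons.1 hj with rfl | hj
      · omega
      · exact hD j hj
    · exact (HoPushout.hEquiv_swap _ _).trans
        (WedgeList.hEquiv_cons (by omega) hD (.refl _) (.refl _) _ _)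

/-- Exchanging the two circles turns the projection onto the joining circle into `(T × S¹) × S¹ → S¹
× S¹ → S¹`. Pasting gives the pushout of `S¹ ← S¹ × S¹ → (T * S¹) × S¹`, and the circle is
nullhomotopic in `T * S¹`. -/
lemma join_prod_hEquiv (T : Type) [TopologicalSpace T] [Nonempty T] :
    ∃ j : Join T, HEquiv (Join (T × Circ)) (HalfJoin j Circ) := by
  obtain ⟨t₀⟩ := ‹Nonempty T›
  refine ⟨HoPushout.inr _ _ t₀, ?_⟩
  let γ : (T × Circ) × Circ ≃ₜ (T × Circ) × Circ :=
    { toFun := fun x => ((x.1.1, x.2), x.1.2)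
      invFun := fun x => ((x.1.1, x.2), x.1.2)
      left_inv := fun _ => rfl
      right_inv := fun _ => rfl
      continuous_toFun := by fun_prop
      continuous_invFun := by fun_prop }
  let f : C((T × Circ) × Circ, Circ × Circ) := ContinuousMap.snd.prodMap (.id Circ)
  let g : C((T × Circ) × Circ, T × Circ) := ContinuousMap.fst.prodMap (.id Circ)
  refine (HoPushout.hEquiv_mapMid ContinuousMap.snd ContinuousMap.fst γ.isHEq).symm.trans ?_
  refine (HoPushout.hEquiv_paste f g ContinuousMap.fst).trans ?_
  obtain ⟨π, hπ, hl⟩ := HoPushout.exists_isHEq_prod (ContinuousMap.snd : C(T × Circ, Circ))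
    (ContinuousMap.fst : C(T × Circ, T)) Circ
  refine (HoPushout.hEquiv_mapRight _ _ hπ).trans ?_
  have e1 : π.comp (HoPushout.inl _ _) =
      (HoPushout.inl (ContinuousMap.snd : C(T × Circ, Circ)) ContinuousMap.fst).prodMap
        (.id Circ) := by
    ext1 x
    exact hl x
  rw [e1]
  have hn : (HoPushout.inl (ContinuousMap.snd : C(T × Circ, Circ)) ContinuousMap.fst).Homotopic
      (.const Circ (HoPushout.inr _ _ t₀)) :=
    HoPushout.inl_nullhomotopic _ _ (.id Circ) ⟨fun s => (t₀, s), by fun_prop⟩ t₀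
      (fun _ => rfl) (fun _ => rfl)
  exact (HoPushout.hEquiv_of_homotopic_right _ (hn.prodMap (.refl (.id Circ)))).trans
    (HoPushout.hEquiv_swap _ _)

/-- The torus, as the part of the moment-angle complex that belongs to the empty face. -/
abbrev Torus (m : ℕ) : Type := facePart (Finset.Icc 1 m) ∅ (discBoundary ℂ)

/-- Splitting off the last circle of a torus. -/
lemma torus_hEquiv (m : ℕ) : HEquiv (Torus (m + 1)) (Torus m × Circ) := by
  unfold Torus
  rw [Icc_succ_eq_insert]
  refine Homeomorph.hEquiv (Homeomorph.trans ?_ (Homeomorph.Set.prod (facePart (Finset.Icc 1 m) ∅ (discBoundary ℂ))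
    (discBoundary ℂ)))
  refine (insertHomeo (isStackable_points m).notMem (Disc ℂ)).subtype fun x => ?_
  constructor
  · exact fun h => ⟨fun w _ => h ⟨w, Finset.mem_insert_of_mem w.2⟩ (Finset.notMem_empty _),
      h ⟨m + 1, Finset.mem_insert_self _ _⟩ (Finset.notMem_empty _)⟩
  · rintro ⟨h1, h2⟩ ⟨w, hw⟩ -
    rcases Finset.mem_insert.1 hw with rfl | hw
    · exact h2
    · exact h1 ⟨w, hw⟩ (Finset.notMem_empty _)

instance (m : ℕ) : Nonempty (Torus m) :=
  ⟨⟨fun _ => ⟨1, by simp⟩, fun _ _ => by simp⟩⟩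

/-- The dimensions of the spheres in the join of the `m`-torus and the circle. -/
def joinDims : ℕ → List ℕ
  | 0 => []
  | m + 1 => halfJoinDims (joinDims m) [3]

lemma one_le_of_mem_joinDims (m : ℕ) : ∀ j ∈ joinDims m, 1 ≤ j := by
  induction m with
  | zero => simp [joinDims]
  | succ m ih => exact one_le_of_mem_halfJoinDims ih (by simp)

lemma join_torus_hEquiv (m : ℕ) : HEquiv (Join (Torus m)) (WedgeList (joinDims m)) := by
  induction m with
  | zero =>
    have : IsEmpty (Finset.Icc 1 0) := ⟨fun i => by simpa using i.2⟩
    have : Subsingleton (Torus 0) := ⟨fun x y => by ext i; exact isEmptyElim i⟩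
    exact (HoPushout.hEquiv_of_isHEq (isHEq_snd (Y := Torus 0) (X := Circ)) _).trans
      (ContractibleSpace.hequiv _ (WedgeList []))
  | succ m ih =>
    have := WedgeList.pathConnectedSpace (one_le_of_mem_joinDims m)
    obtain ⟨j, hj⟩ := join_prod_hEquiv (Torus m)
    refine (Join.congr (torus_hEquiv m)).trans (hj.trans ?_)
    refine (HalfJoin.congr j (WedgeList.base _) Circ ih).trans ?_
    exact HalfJoin.hEquiv_wedgeList (one_le_of_mem_joinDims m) (by simp)
      (join_circ_hEquiv.trans (sphere_hEquiv_wedgeList 3))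

/-- The dimensions of the spheres in the moment-angle complex of `m + 1` points. -/
def pointsDims : ℕ → List ℕ
  | 0 => []
  | m + 1 => halfJoinDims (pointsDims m) (joinDims (m + 1))

lemma one_le_of_mem_pointsDims (m : ℕ) : ∀ j ∈ pointsDims m, 1 ≤ j := by
  induction m with
  | zero => simp [pointsDims]
  | succ m ih => exact one_le_of_mem_halfJoinDims ih (one_le_of_mem_joinDims _)

/-- Adding a point attaches along the torus of the empty face, which is nullhomotopic in the old
complex. The result is the half join with that torus. -/
lemma momentAngle_points_hEquiv (m : ℕ) :
    HEquiv (polyProd (Finset.Icc 1 (m + 1)) (points (Finset.Icc 1 (m + 1))) (discBoundary ℂ))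
      (WedgeList (pointsDims m)) := by
  induction m with
  | zero =>
    rw [points_one]
    have := polyProd_simplex_contractible (A := discBoundary ℂ) (W := Finset.Icc 1 1) (by simp)
    exact ContractibleSpace.hequiv _ (WedgeList [])
  | succ m ih =>
    have hS := isStackable_points (m + 1)
    have hP := WedgeList.pathConnectedSpace (one_le_of_mem_pointsDims m)
    rw [points_succ, Icc_succ_eq_insert (m + 1)]
    obtain ⟨a, ha⟩ := discBoundary_complex_nonempty
    refine (hS.homeo (discBoundary ℂ)).hEquiv.trans ?_
    refine (attach_hEquiv (facePart_subset hS.face hS.face_subset)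
      (isClosed_facePart (isNDR_discBoundary ℂ).isClosed) (isNDR_discBoundary ℂ)).trans ?_
    obtain ⟨φ, hφ⟩ := ih.exists_isHEq
    refine (HoPushout.hEquiv_mapLeft _ _ (hφ.prodMap (isHEq_id (X := Circ)))).trans ?_
    have hn : (inclOf (facePart_subset (A := discBoundary ℂ) hS.face
        hS.face_subset)).Nullhomotopic :=
      ⟨_, facePart_homotopic_const ha hS.face hS.face_subset hS.vertex⟩
    refine (HoPushout.hEquiv_of_homotopic_left _ (((hn.comp_right φ).homotopic_const
      (WedgeList.base _)).prodMap (.refl (.id Circ)))).trans ?_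
    exact HalfJoin.hEquiv_wedgeList (B := Torus (m + 1)) (one_le_of_mem_pointsDims m)
      (one_le_of_mem_joinDims (m + 1)) (join_torus_hEquiv (m + 1))

end Calculation

/-! ### Counting the spheres -/

section Counting

lemma count_halfJoinDims_zero (L E : List ℕ) :
    (halfJoinDims L E).count 0 = L.count 0 + E.count 0 := by
  induction L with
  | nil => simp [halfJoinDims]
  | cons j L ih => simp only [halfJoinDims, List.count_cons, ih]; simp; omega

lemma count_halfJoinDims_succ (L E : List ℕ) (k : ℕ) :
    (halfJoinDims L E).count (k + 1) = L.count (k + 1) + L.count k + E.count (k + 1) := by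
  induction L with
  | nil => simp [halfJoinDims]
  | cons j L ih =>
    simp only [halfJoinDims, List.count_cons, ih]
    simp
    omega

/-- Pascal's rule; for `k = 0` the extra `S³` supplies `m.choose 0`. The vanishing in low dimensions
starts the recursion. -/
lemma count_joinDims (m k : ℕ) : (joinDims m).count (k + 3) = m.choose (k + 1) ∧
    (joinDims m).count 2 = 0 ∧ (joinDims m).count 1 = 0 ∧ (joinDims m).count 0 = 0 := by
  induction m generalizing k with
  | zero => simp [joinDims]
  | succ m ih =>
    simp only [joinDims]
    refine ⟨?_, ?_, ?_, ?_⟩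
    · cases k with
      | zero =>
        rw [count_halfJoinDims_succ, (ih 0).1, (ih 0).2.1]
        simp
      | succ k =>
        rw [count_halfJoinDims_succ, (ih (k + 1)).1, (ih k).1, Nat.choose_succ_succ m (k + 1)]
        simp
        omega
    · rw [count_halfJoinDims_succ, (ih 0).2.1, (ih 0).2.2.1]; simp
    · rw [count_halfJoinDims_succ, (ih 0).2.2.1, (ih 0).2.2.2]; simp
    · rw [count_halfJoinDims_zero, (ih 0).2.2.2]; simp

/-- With `n = m + 1`, the recursion is `(k+1) C(n+1,k+2) = (k+1) C(n,k+2) + k C(n,k+1) + C(n,k+1)`,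
whose last term counts the spheres in the join of the torus with the circle. -/
lemma count_pointsDims (m k : ℕ) :
    (pointsDims m).count (k + 3) = (k + 1) * (m + 1).choose (k + 2) ∧
    (pointsDims m).count 2 = 0 ∧ (pointsDims m).count 1 = 0 ∧ (pointsDims m).count 0 = 0 := by
  induction m generalizing k with
  | zero => simp [pointsDims, Nat.choose_eq_zero_of_lt]
  | succ m ih =>
    have hj := count_joinDims (m + 1)
    simp only [pointsDims]
    refine ⟨?_, ?_, ?_, ?_⟩
    · cases k with
      | zero =>
        rw [count_halfJoinDims_succ, (ih 0).1, (ih 0).2.1, (hj 0).1,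
          Nat.choose_succ_succ (m + 1) 1]
        ring
      | succ k =>
        rw [count_halfJoinDims_succ, (ih (k + 1)).1, (ih k).1, (hj (k + 1)).1,
          Nat.choose_succ_succ (m + 1) (k + 2)]
        ring
    · rw [count_halfJoinDims_succ, (ih 0).2.1, (ih 0).2.2.1, (hj 0).2.1]
    · rw [count_halfJoinDims_succ, (ih 0).2.2.1, (ih 0).2.2.2, (hj 0).2.2.1]
    · rw [count_halfJoinDims_zero, (ih 0).2.2.2, (hj 0).2.2.2]

/-- Two families with fibres of the same sizes differ by a reindexing. -/
lemma exists_equiv_of_card_fiber {ι κ : Type} [Fintype ι] [Fintype κ] (m : ι → ℕ) (n : κ → ℕ)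
    (h : ∀ k, Fintype.card {i // m i = k} = Fintype.card {j // n j = k}) :
    ∃ e : ι ≃ κ, ∀ i, n (e i) = m i := by
  let e : ι ≃ κ := (Equiv.sigmaFiberEquiv m).symm.trans
    ((Equiv.sigmaCongrRight fun k => Fintype.equivOfCardEq (h k)).trans (Equiv.sigmaFiberEquiv n))
  exact ⟨e, fun i => (Fintype.equivOfCardEq (h (m i)) ⟨i, rfl⟩).2⟩

/-- The index shifts because `pointsDims m` belongs to `m + 1` points. Both families have equally
many spheres in each dimension, so a bijection of the indices preserves dimensions. -/
lemma wedgeList_hEquiv_sphereWedge (m : ℕ) :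
    HEquiv (WedgeList (pointsDims m)) (SphereWedge (m + 1)) := by
  obtain ⟨e, he⟩ := exists_equiv_of_card_fiber (fun i => (pointsDims m).get i)
    (fun i : (Σ k : Finset.Icc 3 (m + 1 + 1),
      Fin (((k : ℕ) - 2) * (m + 1).choose ((k : ℕ) - 1))) => (i.1 : ℕ)) (by
    intro k
    have h1 : Fintype.card {i // (pointsDims m).get i = k} = (pointsDims m).count k := by
      rw [Fintype.card_subtype]
      exact (Fin.card_filter_univ_eq_vector_get_eq_count k ⟨pointsDims m, rfl⟩ :)
    rw [h1]
    by_cases hk : k ∈ Finset.Icc 3 (m + 1 + 1)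
    · let ε : {j : (Σ k : Finset.Icc 3 (m + 1 + 1),
        Fin (((k : ℕ) - 2) * (m + 1).choose ((k : ℕ) - 1))) // (j.1 : ℕ) = k} ≃
          Fin ((k - 2) * (m + 1).choose (k - 1)) :=
        { toFun := fun j => Fin.cast (by rw [j.2]) j.1.2
          invFun := fun i => ⟨⟨⟨k, hk⟩, i⟩, rfl⟩
          left_inv := by rintro ⟨⟨⟨j, hj⟩, i⟩, rfl⟩; rfl
          right_inv := fun i => rfl }
      rw [Fintype.card_congr ε, Fintype.card_fin]
      obtain ⟨k, rfl⟩ : ∃ j, k = j + 3 := ⟨k - 3, by simp at hk; omega⟩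
      exact (count_pointsDims m k).1
    · have : IsEmpty {j : (Σ k : Finset.Icc 3 (m + 1 + 1),
          Fin (((k : ℕ) - 2) * (m + 1).choose ((k : ℕ) - 1))) // (j.1 : ℕ) = k} :=
        ⟨fun j => hk (j.2 ▸ j.1.1.2)⟩
      rw [Fintype.card_eq_zero]
      have h3 := count_pointsDims m (k - 3)
      simp only [Finset.mem_Icc, not_and, not_le] at hk
      match k, hk, h3 with
      | 0, _, h3 => exact h3.2.2.2
      | 1, _, h3 => exact h3.2.2.1
      | 2, _, h3 => exact h3.2.1
      | k + 3, hk, h3 =>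
        have := hk (by omega)
        rw [Nat.add_sub_cancel] at h3
        rw [h3.1, Nat.choose_eq_zero_of_lt (by omega), mul_zero])
  exact Wedge.hEquiv_of_equiv e _ _ he

end Counting
end PolyProd

theorem mainTheorem5 (d ℓ : ℕ) (hd : 1 ≤ d) (hℓ : 1 ≤ ℓ) (hdℓ : d = 1 → ℓ ≤ 2) :
    -- the number of `(d-1)`-dimensional faces of the stacked polytope
    {σ | σ ∈ (PolyProd.stacked d ℓ).faces ∧ σ.card = d}.ncard = ℓ * d + 1 ∧
    -- those without the vertex `1`: they are the `ℓ` listed ones, and lie in the boundary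
    {σ | σ ∈ (PolyProd.stacked d ℓ).faces ∧ σ.card = d ∧ 1 ∉ σ} =
      PolyProd.deletedFacet d '' Set.Icc 1 ℓ ∧
    {σ | σ ∈ (PolyProd.boundary d (PolyProd.stacked d ℓ)).faces ∧ σ.card = d ∧ 1 ∉ σ} =
      PolyProd.deletedFacet d '' Set.Icc 1 ℓ ∧
    (PolyProd.deletedFacet d '' Set.Icc 1 ℓ).ncard = ℓ ∧
    -- `∂L - {1}` is glued from `(d-1)`-simplices along `(d-2)`-faces
    PolyProd.IsSuccessiveGluing d ℓ (PolyProd.deleted d ℓ) ∧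
    -- the homotopy equivalence of polyhedral products
    (∀ (X : Type*) [TopologicalSpace X] [Nonempty X],
      Nonempty (ContinuousMap.HomotopyEquiv
        (PolyProd.ConeProduct X (PolyProd.deletedVertices d ℓ) (PolyProd.deleted d ℓ))
        (PolyProd.ConeProduct X (Finset.Icc 1 ℓ) (PolyProd.points (Finset.Icc 1 ℓ))))) ∧
    -- the homotopy equivalences of moment-angle complexes
    Nonempty (ContinuousMap.HomotopyEquiv
      (PolyProd.MomentAngle (PolyProd.deletedVertices d ℓ) (PolyProd.deleted d ℓ))
      (PolyProd.MomentAngle (Finset.Icc 1 ℓ) (PolyProd.points (Finset.Icc 1 ℓ)))) ∧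
    Nonempty (ContinuousMap.HomotopyEquiv
      (PolyProd.MomentAngle (Finset.Icc 1 ℓ) (PolyProd.points (Finset.Icc 1 ℓ)))
      (PolyProd.SphereWedge ℓ)) := by
  refine ⟨PolyProd.ncard_ridges hd hℓ hdℓ, PolyProd.ridges_without_one hd hℓ hdℓ,
    PolyProd.boundary_ridges_without_one hd hℓ hdℓ, PolyProd.ncard_deletedFacets d ℓ,
    PolyProd.isSuccessiveGluing_deleted hd hdℓ, ?_, ?_, ?_⟩
  · intro X _ _
    exact PolyProd.deleted_hEquiv_points PolyProd.Cone.isNDR_base PolyProd.Cone.base_nonempty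
      hd hℓ hdℓ
  · exact PolyProd.deleted_hEquiv_points (PolyProd.isNDR_discBoundary ℂ)
      PolyProd.discBoundary_complex_nonempty hd hℓ hdℓ
  · obtain ⟨m, rfl⟩ : ∃ m, ℓ = m + 1 := ⟨ℓ - 1, by omega⟩
    exact (PolyProd.momentAngle_points_hEquiv m).trans (PolyProd.wedgeList_hEquiv_sphereWedge m)
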